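/- Let $\alpha>0$ and let $G^2_\alpha$ be the $\alpha$-Grushin plane, i.e. $\mathbb{R}^2$ with the vector fields $X=\partial_x$, $Y_\alpha=|x|^\alpha\partial_y$. For open $U\subset\mathbb{R}^2$ and $1\le p<\infty$, $HW^{1,p}(U)$ is the set of $f\in L^p(U)$ (Lebesgue measure) whose first weak partial derivatives exist and satisfy $\partial_xf,\ |x|^\alpha\partial_yf\in L^p(U)$. For open $\Omega,\Omega'\subset\mathbb{R}^2$, a map $g=(g_1,g_2):\Omega\to\Omega'$ is in $HW^{1,p}_{\rm loc}(\Omega,\Omega')$ if $g_1,g_2\in HW^{1,p}(U)$ for all open $U$ with compact closure $\overline U\subset\Omega$. Put $S_g=\{(x,y)\in\Omega : x=0 \text{ or } g_1(x,y)=0\}$, $R_g=\Omega\setminus S_g$ and, with classical partial derivatives, $$D_Hg=\begin{bmatrix}Xg_1&Y_\alpha g_1\\ Xg_2&Y_\alpha g_2\end{bmatrix},\qquad D_\alpha g=\begin{bmatrix}Xg_1&Y_\alpha g_1\\ |g_1|^{-\alpha}Xg_2&|g_1|^{-\alpha}Y_\alpha g_2\end{bmatrix}.$$ A map $g\in HW^{1,1}_{\rm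 loc}(\Omega,\Omega')$ is orientation preserving if $\det D_Hg>0$ a.e. in $\Omega$. A homeomorphism $g$ of $\Omega$ onto $\Omega'$ with $g\in HW^{1,2}_{\rm loc}(\Omega,\Omega')$ is conformal if (1) a.e. in $R_g$ the matrix $D_\alpha g$ is a positive multiple of an orthogonal matrix, and (2) for every $q\in S_g$ the limit of $D_\alpha g$ at $q$ along $R_g$ is defined, finite and non-zero. Let $\varphi_\alpha:\mathbb{R}^2\to\mathbb{C}$, $\varphi_\alpha(x,y)=\frac{x|x|^\alpha}{\alpha+1}+iy$, be the Meyerson map, which is a homeomorphism. A biholomorphism between open subsets of $\mathbb{C}$ is a holomorphic homeomorphism of one onto the other. **Theorem.** Let $\Omega,\Omega'\subset G^2_\alpha$ be open. Then $g\mapsto\widetilde g=\varphi_\alpha\circ g\circ\varphi_\alpha^{-1}$ is a bijection from the set of orientation preserving conformal maps $g:\Omega\to\Omega'$ with $g\in HW^{1,2(\alpha+1)/\alpha}_{\rm loc}(\Omega,\Omega')$ onto the set of biholomorphisms $\widetilde g:\varphi_\alpha(\Omega)\to\varphi_\alpha(\Omega')$ such that, for $z\in\varphi_\alpha(\Omega)$,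 $\operatorname{Re}\widetilde g(z)=0$ if and only if $\operatorname{Re}z=0$. Moreover, every such $g=(g_1,g_2)$ satisfies, for $(x,y)\in\Omega$, $g_1(x,y)=0$ if and only if $x=0$. -/

import Mathlib

open MeasureTheory Filter Topology
open scoped ContDiff

namespace Grushin

noncomputable section

/-! ### The Meyerson map -/

/-- The real function `x ↦ x |x|^α / (α + 1)`. -/
def stretch (α x : ℝ) : ℝ := x * |x| ^ α / (α + 1)

/-- The real function `x ↦ sign(x) [(α + 1) |x|]^{1/(α+1)}`, the inverse of `stretch α`. -/
def unstretch (α x : ℝ) : ℝ := Real.sign x * ((α + 1) * |x|) ^ (1 / (α + 1))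

theorem unstretch_stretch {α : ℝ} (hα : 0 < α) (x : ℝ) : unstretch α (stretch α x) = x := by
  have h1 : (0 : ℝ) < α + 1 := by linarith
  have key : ∀ y : ℝ, 0 < y → ((α + 1) * |y * y ^ α / (α + 1)|) ^ (1 / (α + 1)) = y := by
    intro y hy
    have hp : 0 < y ^ α := Real.rpow_pos_of_pos hy α
    rw [abs_of_pos (by positivity)]
    have : (α + 1) * (y * y ^ α / (α + 1)) = y ^ (α + 1) := by
      rw [Real.rpow_add hy, Real.rpow_one]; field_simp
    rw [this, ← Real.rpow_mul hy.le, mul_one_div_cancel h1.ne', Real.rpow_one]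
  unfold unstretch stretch
  rcases lt_trichotomy x 0 with hx | hx | hx
  · have hx' : 0 < -x := by linarith
    have hp : 0 < (-x) ^ α := Real.rpow_pos_of_pos hx' α
    have hneg : x * |x| ^ α / (α + 1) < 0 := by
      rw [abs_of_neg hx]
      exact div_neg_of_neg_of_pos (mul_neg_of_neg_of_pos hx hp) h1
    rw [Real.sign_of_neg hneg, abs_of_neg hx]
    have h2 : x * (-x) ^ α / (α + 1) = -((-x) * (-x) ^ α / (α + 1)) := by ring
    rw [h2, abs_neg, key _ hx']; ring
  · subst hx; simp
  · have hp : 0 < x ^ α := Real.rpow_pos_of_pos hx α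
    rw [abs_of_pos hx, Real.sign_of_pos (by positivity), key _ hx, one_mul]

theorem stretch_unstretch {α : ℝ} (hα : 0 < α) (x : ℝ) : stretch α (unstretch α x) = x := by
  have h1 : (0 : ℝ) < α + 1 := by linarith
  have key : ∀ y : ℝ, 0 < y →
      ((α + 1) * y) ^ (1 / (α + 1)) * (((α + 1) * y) ^ (1 / (α + 1))) ^ α / (α + 1) = y := by
    intro y hy
    have hz : 0 < (α + 1) * y := by positivity
    rw [← Real.rpow_mul hz.le, ← Real.rpow_add hz]
    have : 1 / (α + 1) + 1 / (α + 1) * α = 1 := by field_simp; ring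
    rw [this, Real.rpow_one]; field_simp
  unfold unstretch stretch
  rcases lt_trichotomy x 0 with hx | hx | hx
  · have hx' : 0 < -x := by linarith
    have hp : 0 < ((α + 1) * -x) ^ (1 / (α + 1)) := Real.rpow_pos_of_pos (by positivity) _
    rw [Real.sign_of_neg hx, abs_of_neg hx, neg_one_mul, abs_neg, abs_of_pos hp, neg_mul, neg_div,
      key _ hx', neg_neg]
  · subst hx; simp
  · have hp : 0 < ((α + 1) * x) ^ (1 / (α + 1)) := Real.rpow_pos_of_pos (by positivity) _
    rw [Real.sign_of_pos hx, abs_of_pos hx, one_mul, abs_of_pos hp, key _ hx]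

theorem continuous_stretch {α : ℝ} (hα : 0 < α) : Continuous (stretch α) := by
  unfold stretch
  exact (continuous_id.mul (continuous_abs.rpow_const fun _ => Or.inr hα.le)).div_const _

theorem continuous_unstretch {α : ℝ} (hα : 0 < α) : Continuous (unstretch α) := by
  have h1 : (0 : ℝ) < 1 / (α + 1) := by positivity
  have h : unstretch α = fun x => ((α + 1) * max x 0) ^ (1 / (α + 1)) -
      ((α + 1) * max (-x) 0) ^ (1 / (α + 1)) := by
    funext x
    unfold unstretch
    rcases lt_trichotomy x 0 with hx | hx | hx
    · rw [Real.sign_of_neg hx, abs_of_neg hx, max_eq_right hx.le, max_eq_left (by linarith),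
        mul_zero, Real.zero_rpow h1.ne']; ring
    · subst hx; simp
    · rw [Real.sign_of_pos hx, abs_of_pos hx, max_eq_left hx.le, max_eq_right (by linarith),
        mul_zero, Real.zero_rpow h1.ne']; ring
  rw [h]
  exact ((continuous_const.mul (continuous_id.max continuous_const)).rpow_const
      fun _ => Or.inr h1.le).sub
    ((continuous_const.mul (continuous_neg.max continuous_const)).rpow_const
      fun _ => Or.inr h1.le)

/-- The Meyerson map `φ_α (x, y) = x |x|^α / (α + 1) + i y`, a homeomorphism from the
`α`-Grushin plane (as a set and as a topological space, `ℝ × ℝ`) onto `ℂ`. -/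
def meyerson (α : ℝ) (hα : 0 < α) : (ℝ × ℝ) ≃ₜ ℂ where
  toFun p := ⟨stretch α p.1, p.2⟩
  invFun z := (unstretch α z.re, z.im)
  left_inv p := by simp [unstretch_stretch hα]
  right_inv z := by simp [stretch_unstretch hα]
  continuous_toFun := by
    have := (continuous_stretch hα).comp (continuous_fst (X := ℝ) (Y := ℝ))
    exact Complex.equivRealProdCLM.symm.continuous.comp (this.prodMk continuous_snd)
  continuous_invFun :=
    ((continuous_unstretch hα).comp Complex.continuous_re).prodMk Complex.continuous_im

/-- The conjugate `φ_α ∘ g ∘ φ_α⁻¹ : φ_α(Ω) → φ_α(Ω')` of a homeomorphism `g : Ω → Ω'`. -/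
def conjugate (α : ℝ) (hα : 0 < α) {Ω Ω' : Set (ℝ × ℝ)} (g : Ω ≃ₜ Ω') :
    (meyerson α hα '' Ω) ≃ₜ (meyerson α hα '' Ω') :=
  (((meyerson α hα).image Ω).symm.trans g).trans ((meyerson α hα).image Ω')

/-! ### Horizontal Sobolev spaces -/

/-- `u` is the weak derivative of `f` in the direction `e` on the open set `U ⊆ ℝ²`. -/
def IsWeakDeriv (U : Set (ℝ × ℝ)) (e : ℝ × ℝ) (f u : ℝ × ℝ → ℝ) : Prop :=
  LocallyIntegrableOn f U volume ∧ LocallyIntegrableOn u U volume ∧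
    ∀ ψ : ℝ × ℝ → ℝ, ContDiff ℝ ∞ ψ → HasCompactSupport ψ → tsupport ψ ⊆ U →
      ∫ p in U, f p * fderiv ℝ ψ p e = -∫ p in U, u p * ψ p

/-- The horizontal Sobolev space `HW^{1,p,α}(U)`: `f ∈ L^p(U)`, the weak partial derivatives
`u = ∂f/∂x` and `v = ∂f/∂y` exist on `U`, and the horizontal gradient `(u, |x|^α v)` is in
`L^p(U)`. -/
def MemHW (α : ℝ) (p : ENNReal) (U : Set (ℝ × ℝ)) (f : ℝ × ℝ → ℝ) : Prop :=
  MemLp f p (volume.restrict U) ∧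
    ∃ u v : ℝ × ℝ → ℝ, IsWeakDeriv U (1, 0) f u ∧ IsWeakDeriv U (0, 1) f v ∧
      MemLp u p (volume.restrict U) ∧
      MemLp (fun q => |q.1| ^ α * v q) p (volume.restrict U)

/-- The map `g : Ω → Ω'` as a map of the plane, extended by zero outside `Ω`; only its values on
`Ω` (and, `Ω` being open, its derivatives there) are used below. -/
def ext {Ω Ω' : Set (ℝ × ℝ)} (g : Ω ≃ₜ Ω') : ℝ × ℝ → ℝ × ℝ :=
  Function.extend Subtype.val (fun p : Ω => (g p : ℝ × ℝ)) 0

/-- First component `g₁` of `g`. -/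
def comp₁ {Ω Ω' : Set (ℝ × ℝ)} (g : Ω ≃ₜ Ω') (p : ℝ × ℝ) : ℝ := (ext g p).1

/-- Second component `g₂` of `g`. -/
def comp₂ {Ω Ω' : Set (ℝ × ℝ)} (g : Ω ≃ₜ Ω') (p : ℝ × ℝ) : ℝ := (ext g p).2

/-- `g ∈ HW^{1,p,α}_loc(Ω, Ω')`: both components are in `HW^{1,p,α}(U)` for every open `U`
whose (Euclidean) closure is compact and contained in `Ω`. -/
def MemHWLoc (α : ℝ) (p : ENNReal) {Ω Ω' : Set (ℝ × ℝ)} (g : Ω ≃ₜ Ω') : Prop :=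
  ∀ U : Set (ℝ × ℝ), IsOpen U → IsCompact (closure U) → closure U ⊆ Ω →
    MemHW α p U (comp₁ g) ∧ MemHW α p U (comp₂ g)

/-! ### Grushin-conformal maps -/

/-- The (classical) derivative `X f = ∂f/∂x`. -/
def X (f : ℝ × ℝ → ℝ) (p : ℝ × ℝ) : ℝ := deriv (fun t => f (t, p.2)) p.1

/-- The (classical) derivative `Y_α f = |x|^α ∂f/∂y`. -/
def Y (α : ℝ) (f : ℝ × ℝ → ℝ) (p : ℝ × ℝ) : ℝ := |p.1| ^ α * deriv (fun t => f (p.1, t)) p.2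

/-- Both classical partial derivatives of `f` exist at `p`. -/
def HasPartials (f : ℝ × ℝ → ℝ) (p : ℝ × ℝ) : Prop :=
  DifferentiableAt ℝ (fun t => f (t, p.2)) p.1 ∧ DifferentiableAt ℝ (fun t => f (p.1, t)) p.2

section Maps

variable {Ω Ω' : Set (ℝ × ℝ)}

/-- The set of points of `Ω` at which all classical partial derivatives of `g` exist. -/
def partialsSet (g : Ω ≃ₜ Ω') : Set (ℝ × ℝ) :=
  {p ∈ Ω | HasPartials (comp₁ g) p ∧ HasPartials (comp₂ g) p}

/-- The singular set `S_g = {(x, y) ∈ Ω | x = 0 or g₁(x, y) = 0}`. -/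
def singularSet (g : Ω ≃ₜ Ω') : Set (ℝ × ℝ) := {p ∈ Ω | p.1 = 0 ∨ comp₁ g p = 0}

/-- The regular set `R_g = Ω \ S_g`. -/
def regularSet (g : Ω ≃ₜ Ω') : Set (ℝ × ℝ) := Ω \ singularSet g

/-- The matrix `D_H g`. -/
def horizontalMatrix (α : ℝ) (g : Ω ≃ₜ Ω') (p : ℝ × ℝ) : Matrix (Fin 2) (Fin 2) ℝ :=
  !![X (comp₁ g) p, Y α (comp₁ g) p;
     X (comp₂ g) p, Y α (comp₂ g) p]

/-- The matrix `D_α g`, meaningful where `g₁ ≠ 0`. -/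
def grushinMatrix (α : ℝ) (g : Ω ≃ₜ Ω') (p : ℝ × ℝ) : Matrix (Fin 2) (Fin 2) ℝ :=
  !![X (comp₁ g) p, Y α (comp₁ g) p;
     X (comp₂ g) p / |comp₁ g p| ^ α, Y α (comp₂ g) p / |comp₁ g p| ^ α]

/-- Orientation preserving: `g ∈ HW^{1,1}_loc` and `J_g = det D_H g > 0` almost everywhere in
`Ω`. -/
def IsOrientationPreserving (α : ℝ) (g : Ω ≃ₜ Ω') : Prop :=
  MemHWLoc α 1 g ∧
    ∀ᵐ p : ℝ × ℝ, p ∈ Ω → p ∈ partialsSet g ∧ 0 < (horizontalMatrix α g p).det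

/-- Conformality in the Grushin plane of the homeomorphism `g : Ω → Ω'`: `g ∈ HW^{1,2}_loc`;
`D_α g` is almost everywhere in `R_g` a positive multiple of an orthogonal matrix; and at every
point of `S_g` the matrix `D_α g` has a finite nonzero limit along `R_g`. The limit is taken along
the points of `R_g` at which the entries of `D_α g` are defined, and being defined includes that
the point is an accumulation point of these. -/
structure IsConformal (α : ℝ) (g : Ω ≃ₜ Ω') : Prop where
  memHWLoc : MemHWLoc α 2 g
  orthogonal : ∀ᵐ p : ℝ × ℝ, p ∈ regularSet g → p ∈ partialsSet g ∧
    ∃ c : ℝ, 0 < c ∧ ∃ O ∈ Matrix.orthogonalGroup (Fin 2) ℝ, grushinMatrix α g p = c • O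
  limit : ∀ p₀ ∈ singularSet g, (𝓝[regularSet g ∩ partialsSet g] p₀).NeBot ∧
    ∃ L : Matrix (Fin 2) (Fin 2) ℝ, L ≠ 0 ∧
      Tendsto (grushinMatrix α g) (𝓝[regularSet g ∩ partialsSet g] p₀) (𝓝 L)

end Maps

/-- The orientation preserving conformal maps `g : Ω → Ω'` of class `HW^{1, 2(α+1)/α}_loc`. -/
def grushinConformalMaps (α : ℝ) (Ω Ω' : Set (ℝ × ℝ)) : Set (Ω ≃ₜ Ω') :=
  {g | IsConformal α g ∧ IsOrientationPreserving α g ∧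
    MemHWLoc α (ENNReal.ofReal (2 * (α + 1) / α)) g}

/-! ### Conformal maps in the complex plane -/

/-- A homeomorphism `h : U → V` between open subsets of `ℂ` is a biholomorphism if it is
holomorphic on `U` (here `h` is extended by zero outside `U`). -/
def IsBiholomorphism {U V : Set ℂ} (h : U ≃ₜ V) : Prop :=
  DifferentiableOn ℂ (Function.extend Subtype.val (fun z : U => (h z : ℂ)) 0) U

/-- The biholomorphisms `h : U → V` such that `Re h(z) = 0` if and only if `Re z = 0`. -/
def axisBiholomorphisms (U V : Set ℂ) : Set (U ≃ₜ V) :=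
  {h | IsBiholomorphism h ∧ ∀ z : U, (h z : ℂ).re = 0 ↔ (z : ℂ).re = 0}

end

end Grushin

/-!
Conjugation by `φ_α` turns `D_α g` into `(|x| / |g₁|)^α` times the Jacobian matrix of `g̃`. So for
`g` conformal and orientation preserving, `g̃` satisfies the Cauchy-Riemann equations almost
everywhere; since `g` is absolutely continuous on almost all lines, the integral of `g̃` over the
boundary of every rectangle vanishes and Morera's theorem makes `g̃` holomorphic. Its derivative has
no zeros by injectivity, and a finite nonzero limit of `D_α g` then forces `x` and `g₁` to vanish at
the same points. Conversely, if `g̃` is biholomorphic and preserves the imaginary axis, then `g̃'`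
is real on the axis, so `Re g̃ (z)` is comparable to `Re z` and `Im g̃' (z)` is `O(Re z)`. Hence
`|x| / |g₁|` has a positive limit at the axis and the horizontal gradient of `g` is locally bounded.
-/

namespace Grushin

open Set
open scoped Interval

/-! ### Weak derivatives on an interval -/

/-- The function `ψ` is a test function on `U`; unbundled form of `TestFunction`, matching
`IsWeakDeriv`. -/
structure IsTestFunction {E : Type*} [NormedAddCommGroup E] [NormedSpace ℝ E] (U : Set E)
    (ψ : E → ℝ) : Prop where
  contDiff : ContDiff ℝ ∞ ψ
  hasCompactSupport : HasCompactSupport ψ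
  tsupport_subset : tsupport ψ ⊆ U

namespace IsTestFunction

variable {E : Type*} [NormedAddCommGroup E] [NormedSpace ℝ E] {U : Set E} {ψ ψ' : E → ℝ}

theorem continuous (h : IsTestFunction U ψ) : Continuous ψ := h.contDiff.continuous

theorem apply_eq_zero (h : IsTestFunction U ψ) {x : E} (hx : x ∉ U) : ψ x = 0 :=
  image_eq_zero_of_notMem_tsupport fun hx' => hx (h.tsupport_subset hx')

theorem sub_const_mul (h : IsTestFunction U ψ) (h' : IsTestFunction U ψ') (c : ℝ) :
    IsTestFunction U fun x => ψ x - c * ψ' x where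
  contDiff := h.contDiff.sub (contDiff_const.mul h'.contDiff)
  hasCompactSupport := h.hasCompactSupport.sub h'.hasCompactSupport.mul_left
  tsupport_subset := (tsupport_sub _ _).trans
    (union_subset h.tsupport_subset (tsupport_mul_subset_right.trans h'.tsupport_subset))

theorem fderiv_apply (h : IsTestFunction U ψ) (e : E) :
    IsTestFunction U fun x => fderiv ℝ ψ x e where
  contDiff := (h.contDiff.fderiv_right (by simp)).clm_apply contDiff_const
  hasCompactSupport := h.hasCompactSupport.fderiv_apply ℝ e
  tsupport_subset := (tsupport_fderiv_apply_subset ℝ e).trans h.tsupport_subset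

theorem deriv {U : Set ℝ} {χ : ℝ → ℝ} (h : IsTestFunction U χ) : IsTestFunction U (deriv χ) :=
  h.fderiv_apply 1

variable [MeasurableSpace E] {μ : Measure E}

theorem setIntegral_mul_eq_integral (h : IsTestFunction U ψ) (f : E → ℝ) :
    ∫ x in U, f x * ψ x ∂μ = ∫ x, f x * ψ x ∂μ :=
  setIntegral_eq_integral_of_forall_compl_eq_zero fun x hx => by rw [h.apply_eq_zero hx, mul_zero]

variable [BorelSpace E]

theorem integrable [IsFiniteMeasureOnCompacts μ] (h : IsTestFunction U ψ) : Integrable ψ μ :=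
  h.continuous.integrable_of_hasCompactSupport h.hasCompactSupport

theorem integrableOn_mul (h : IsTestFunction U ψ) {f : E → ℝ} (hf : IntegrableOn f U μ) :
    IntegrableOn (fun x => f x * ψ x) U μ := by
  obtain ⟨C, hC⟩ := h.hasCompactSupport.exists_bound_of_continuous h.continuous
  exact Integrable.mul_bdd (c := C) hf
    (h.continuous.stronglyMeasurable_of_hasCompactSupport h.hasCompactSupport).aestronglyMeasurable
    (Eventually.of_forall hC)

end IsTestFunction

section Interval

variable {a b : ℝ}

theorem exists_isTestFunction_deriv_eq_of_integral_eq_zero (hab : a < b) {σ : ℝ → ℝ}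
    (hσ : IsTestFunction (Ioo a b) σ) (h0 : ∫ x, σ x = 0) :
    ∃ χ : ℝ → ℝ, IsTestFunction (Ioo a b) χ ∧ deriv χ = σ := by
  have hK : IsCompact (tsupport σ) := hσ.hasCompactSupport
  obtain ⟨a', ha', b', hb', hsub⟩ : ∃ a' > a, ∃ b' < b, tsupport σ ⊆ Icc a' b' := by
    rcases (tsupport σ).eq_empty_or_nonempty with h | hne
    · exact ⟨b, hab, a, hab, h ▸ empty_subset _⟩
    · exact ⟨sInf _, (hσ.tsupport_subset (hK.sInf_mem hne)).1, sSup _,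
        (hσ.tsupport_subset (hK.sSup_mem hne)).2, subset_Icc_csInf_csSup hK.bddBelow hK.bddAbove⟩
  have hderiv : ∀ x, HasDerivAt (fun x => ∫ t in a..x, σ t) (σ x) x := fun x =>
    hσ.continuous.integral_hasStrictDerivAt a x |>.hasDerivAt
  have hderiv' : deriv (fun x => ∫ t in a..x, σ t) = σ := funext fun x => (hderiv x).deriv
  have hsupp : Function.support (fun x => ∫ t in a..x, σ t) ⊆ Icc a' b' := by
    refine Function.support_subset_iff'.2 fun x hx => ?_
    rcases lt_or_ge x a' with hxa | hxa
    · refine intervalIntegral.integral_zero_ae (Eventually.of_forall fun t ht => ?_)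
      refine image_eq_zero_of_notMem_tsupport fun ht' => (hsub ht').1.not_gt ?_
      exact ht.2.trans_lt (max_lt ha' hxa)
    · have hbx : b' < x := by simpa [hxa] using hx
      rw [intervalIntegral.integral_eq_integral_of_support_subset, h0]
      intro t ht
      exact Icc_subset_Ioc ha' hbx.le (hsub (subset_tsupport _ ht))
  exact ⟨fun x => ∫ t in a..x, σ t,
    ⟨contDiff_infty_iff_deriv.2
      ⟨fun x => (hderiv x).differentiableAt, hderiv'.symm ▸ hσ.contDiff⟩,
      HasCompactSupport.of_support_subset_isCompact isCompact_Icc hsupp,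
      (closure_minimal hsupp isClosed_Icc).trans (Icc_subset_Ioo ha' hb')⟩, hderiv'⟩

theorem exists_isTestFunction_integral_eq_one (hab : a < b) :
    ∃ ρ : ℝ → ℝ, IsTestFunction (Ioo a b) ρ ∧ ∫ x, ρ x = 1 := by
  let β : ContDiffBump ((a + b) / 2) :=
    { rIn := (b - a) / 8, rOut := (b - a) / 4, rIn_pos := by linarith, rIn_lt_rOut := by linarith }
  refine ⟨β.normed volume, ⟨β.contDiff_normed, β.hasCompactSupport_normed, ?_⟩, β.integral_normed⟩
  rw [β.tsupport_normed_eq, Real.closedBall_eq_Icc]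
  exact Icc_subset_Ioo (by change a < _ - (b - a) / 4; linarith)
    (by change _ + (b - a) / 4 < b; linarith)

theorem ae_eq_const_of_integral_mul_deriv_eq_zero {M : ℝ → ℝ} (hM : IntegrableOn M (Ioo a b))
    (h : ∀ χ, IsTestFunction (Ioo a b) χ → ∫ x in Ioo a b, M x * deriv χ x = 0) :
    ∃ c, M =ᵐ[volume.restrict (Ioo a b)] fun _ => c := by
  rcases le_or_gt b a with hba | hab
  · exact ⟨0, by simp [Ioo_eq_empty hba.not_gt, EventuallyEq]⟩
  obtain ⟨ρ₀, hρ₀, hρ₀1⟩ := exists_isTestFunction_integral_eq_one hab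
  set c := ∫ x in Ioo a b, M x * ρ₀ x with hc
  have hMc : IntegrableOn (fun x => M x - c) (Ioo a b) := hM.sub (by simp)
  suffices H : ∀ᵐ x, x ∈ Ioo a b → M x - c = 0 from
    ⟨c, (ae_restrict_iff' measurableSet_Ioo).2 (by simpa only [sub_eq_zero] using H)⟩
  refine isOpen_Ioo.ae_eq_zero_of_integral_contDiff_smul_eq_zero hMc.locallyIntegrableOn
    fun ρ hρ hρc hρs => ?_
  have hρ' : IsTestFunction (Ioo a b) ρ := ⟨hρ, hρc, hρs⟩
  obtain ⟨χ, hχ, hχρ⟩ := exists_isTestFunction_deriv_eq_of_integral_eq_zero hab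
    (hρ'.sub_const_mul hρ₀ (∫ x, ρ x)) (by
      rw [integral_sub hρ'.integrable (hρ₀.integrable.const_mul _), integral_const_mul, hρ₀1]
      ring)
  have hρI : ∫ x in Ioo a b, ρ x = ∫ x, ρ x := by
    simpa using hρ'.setIntegral_mul_eq_integral (μ := volume) 1
  calc ∫ x, ρ x • (M x - c)
      = ∫ x in Ioo a b, (M x - c) * ρ x := by
        simp_rw [hρ'.setIntegral_mul_eq_integral, smul_eq_mul, mul_comm]
    _ = (∫ x in Ioo a b, M x * ρ x) - (∫ x, ρ x) * c := by
        simp_rw [sub_mul]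
        rw [integral_sub (hρ'.integrableOn_mul hM) (hρ'.integrable.integrableOn.const_mul c),
          integral_const_mul, hρI, mul_comm c]
    _ = ∫ x in Ioo a b, M x * deriv χ x := by
        simp_rw [hχρ, mul_sub, mul_left_comm (M _)]
        rw [integral_sub (hρ'.integrableOn_mul hM) ((hρ₀.integrableOn_mul hM).const_mul _),
          integral_const_mul, hc]
    _ = 0 := h χ hχ

end Interval

/-! ### Primitives of integrable functions -/

theorem absolutelyContinuousOnInterval_congr {F G : ℝ → ℝ} {a b : ℝ} (h : EqOn F G [[a, b]])
    (hF : AbsolutelyContinuousOnInterval F a b) : AbsolutelyContinuousOnInterval G a b := by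
  refine Tendsto.congr' (mem_inf_of_right (mem_principal.2 fun E hE => ?_)) hF
  exact Finset.sum_congr rfl fun i hi => by rw [h (hE.1 i hi).1, h (hE.1 i hi).2]

theorem absolutelyContinuousOnInterval_comp {S F : ℝ → ℝ} {a b : ℝ} (hS : ContDiff ℝ 1 S)
    (hF : AbsolutelyContinuousOnInterval F a b) :
    AbsolutelyContinuousOnInterval (S ∘ F) a b := by
  obtain ⟨C, hC⟩ := hF.exists_bound
  obtain ⟨K, hK⟩ := hS.contDiffOn.exists_lipschitzOnWith (by decide) (convex_Icc (-C) C)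
    isCompact_Icc
  have hmem : ∀ x ∈ [[a, b]], F x ∈ Icc (-C) C := fun x hx => abs_le.1 (hC x hx)
  refine squeeze_zero' (Eventually.of_forall fun E => Finset.sum_nonneg fun i _ => dist_nonneg)
    (mem_inf_of_right (mem_principal.2 fun E hE => ?_)) 
    (by simpa using Tendsto.const_mul (K : ℝ) hF)
  rw [mem_ofPred_eq, Finset.mul_sum]
  exact Finset.sum_le_sum fun i hi =>
    hK.dist_le_mul _ (hmem _ (hE.1 i hi).1) _ (hmem _ (hE.1 i hi).2)

/-- The function `F` is a primitive of the integrable function `k` on the set `I`, in the sense of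
the fundamental theorem of calculus; see `isPrimitiveOn_uIcc_iff` for compact intervals. -/
def IsPrimitiveOn (F k : ℝ → ℝ) (I : Set ℝ) : Prop :=
  IntegrableOn k I ∧ ∀ s ∈ I, ∀ t ∈ I, F t - F s = ∫ x in s..t, k x

theorem isPrimitiveOn_uIcc_iff {F k : ℝ → ℝ} {a b : ℝ} :
    IsPrimitiveOn F k [[a, b]] ↔ AbsolutelyContinuousOnInterval F a b ∧
      ∀ᵐ x ∂volume.restrict [[a, b]], HasDerivAt F (k x) x := by
  constructor
  · rintro ⟨hk, hFk⟩
    have hki : IntervalIntegrable k volume a b := hk.intervalIntegrable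
    have hF : ∀ x ∈ [[a, b]], (∫ v in a..x, k v) + F a = F x := fun x hx => by
      rw [← hFk a left_mem_uIcc x hx, sub_add_cancel]
    refine ⟨absolutelyContinuousOnInterval_congr hF
      ((hki.absolutelyContinuousOnInterval_intervalIntegral left_mem_uIcc).add
        contDiff_const.contDiffOn.absolutelyContinuousOnInterval), ?_⟩
    rw [uIcc, ← restrict_Ioo_eq_restrict_Icc, ae_restrict_iff' measurableSet_Ioo]
    filter_upwards [hki.ae_hasDerivAt_integral] with x hx hxab
    have hprim := (hx (Ioo_subset_Icc_self hxab) a left_mem_uIcc).add_const (F a)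
    refine hprim.congr_of_eventuallyEq ?_
    filter_upwards [Icc_mem_nhds hxab.1 hxab.2] with t ht using (hF t ht).symm
  · rintro ⟨hF, hFk⟩
    have hderiv : deriv F =ᵐ[volume.restrict [[a, b]]] k := hFk.mono fun x hx => hx.deriv
    refine ⟨((intervalIntegrable_iff').1 hF.intervalIntegrable_deriv).congr hderiv,
      fun s hs t ht => ?_⟩
    have hst : [[s, t]] ⊆ [[a, b]] := uIcc_subset_uIcc hs ht
    rw [← (hF.mono hst).integral_deriv_eq_sub]
    exact intervalIntegral.integral_congr_ae_restrict
      (ae_restrict_of_ae_restrict_of_subset (uIoc_subset_uIcc.trans hst) hderiv)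

theorem IsPrimitiveOn.comp {F k S : ℝ → ℝ} {a b : ℝ} (hS : ContDiff ℝ 1 S)
    (h : IsPrimitiveOn F k [[a, b]]) :
    IsPrimitiveOn (S ∘ F) (fun x => deriv S (F x) * k x) [[a, b]] := by
  rw [isPrimitiveOn_uIcc_iff] at h ⊢
  exact ⟨absolutelyContinuousOnInterval_comp hS h.1, h.2.mono fun x hx =>
    (hS.differentiable one_ne_zero (F x)).hasDerivAt.comp x hx⟩

theorem isPrimitiveOn_uIcc_of_left {F k : ℝ → ℝ} {a b : ℝ} (hk : IntegrableOn k [[a, b]])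
    (h : ∀ x ∈ [[a, b]], F x - F a = ∫ v in a..x, k v) : IsPrimitiveOn F k [[a, b]] := by
  have hi : ∀ x ∈ [[a, b]], IntervalIntegrable k volume a x := fun x hx =>
    (hk.mono_set (uIcc_subset_uIcc_left hx)).intervalIntegrable
  refine ⟨hk, fun s hs t ht => ?_⟩
  rw [← intervalIntegral.integral_interval_sub_left (hi t ht) (hi s hs), ← h t ht, ← h s hs]
  ring

theorem IsPrimitiveOn.integral_mul_deriv_eq {F k χ : ℝ → ℝ} {a b : ℝ} (hab : a ≤ b)
    (hF : IsPrimitiveOn F k (Icc a b)) (hχ : IsTestFunction (Ioo a b) χ) :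
    ∫ x in Ioo a b, F x * deriv χ x = -∫ x in Ioo a b, k x * χ x := by
  rw [← uIcc_of_le hab, isPrimitiveOn_uIcc_iff] at hF
  have hχac : AbsolutelyContinuousOnInterval χ a b :=
    (hχ.contDiff.of_le (by simp)).contDiffOn.absolutelyContinuousOnInterval
  have hderiv : ∫ x in a..b, deriv F x * χ x = ∫ x in a..b, k x * χ x := by
    refine intervalIntegral.integral_congr_ae_restrict
      (ae_restrict_of_ae_restrict_of_subset uIoc_subset_uIcc ?_)
    filter_upwards [hF.2] with x hx using by rw [hx.deriv]
  have hparts := hF.1.integral_mul_deriv_eq_deriv_mul hχac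
  rw [hderiv, hχ.apply_eq_zero (by simp), hχ.apply_eq_zero (by simp)] at hparts
  simpa [intervalIntegral.integral_of_le hab, integral_Ioc_eq_integral_Ioo] using hparts

theorem isPrimitiveOn_of_integral_mul_deriv_eq {a b : ℝ} {H K : ℝ → ℝ}
    (hH : ContinuousOn H (Icc a b)) (hK : IntegrableOn K (Ioo a b))
    (h : ∀ χ, IsTestFunction (Ioo a b) χ →
      ∫ x in Ioo a b, H x * deriv χ x = -∫ x in Ioo a b, K x * χ x) :
    IsPrimitiveOn H K (Icc a b) := by
  have hKI : IntegrableOn K (Icc a b) := (integrableOn_Icc_iff_integrableOn_Ioo).2 hK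
  rcases lt_trichotomy a b with hab | rfl | hab
  · set P : ℝ → ℝ := fun x => ∫ v in a..x, K v
    have hP : IsPrimitiveOn P K (Icc a b) :=
      uIcc_of_le hab.le ▸ isPrimitiveOn_uIcc_of_left (uIcc_of_le hab.le ▸ hKI) (by simp [P])
    have hPc : ContinuousOn P (Icc a b) := uIcc_of_le hab.le ▸
      (isPrimitiveOn_uIcc_iff.1 (uIcc_of_le hab.le ▸ hP)).1.continuousOn
    have hHi : IntegrableOn H (Ioo a b) := hH.integrableOn_Icc.mono_set Ioo_subset_Icc_self
    have hPi : IntegrableOn P (Ioo a b) := hPc.integrableOn_Icc.mono_set Ioo_subset_Icc_self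
    obtain ⟨c, hc⟩ := ae_eq_const_of_integral_mul_deriv_eq_zero (hHi.sub hPi) fun χ hχ => by
      simp_rw [Pi.sub_apply, sub_mul]
      rw [integral_sub (hχ.deriv.integrableOn_mul hHi) (hχ.deriv.integrableOn_mul hPi), h χ hχ,
        hP.integral_mul_deriv_eq hab.le hχ, sub_self]
    have hHP : ∀ x ∈ Icc a b, H x - P x = c := Measure.eqOn_Icc_of_ae_eq volume hab.ne
      (restrict_Ioo_eq_restrict_Icc (μ := volume) (a := a) ▸ hc) (hH.sub hPc) continuousOn_const
    exact ⟨hKI, fun s hs t ht => by linarith [hP.2 s hs t ht, hHP s hs, hHP t ht]⟩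
  · exact ⟨hKI, fun s hs t ht => by simp [le_antisymm hs.2 hs.1, le_antisymm ht.2 ht.1]⟩
  · exact ⟨hKI, by simp [hab]⟩

/-! ### Weak derivatives in the plane -/

theorem measurePreserving_swap_real :
    MeasurePreserving (Prod.swap : ℝ × ℝ → ℝ × ℝ) volume volume :=
  Measure.measurePreserving_swap

theorem measurableEmbedding_swap_real : MeasurableEmbedding (Prod.swap : ℝ × ℝ → ℝ × ℝ) :=
  MeasurableEquiv.prodComm.measurableEmbedding

theorem locallyIntegrableOn_comp_swap {U : Set (ℝ × ℝ)} (hU : IsOpen U) {f : ℝ × ℝ → ℝ}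
    (hf : LocallyIntegrableOn f U) : LocallyIntegrableOn (f ∘ Prod.swap) (Prod.swap ⁻¹' U) := by
  rw [locallyIntegrableOn_iff (hU.preimage continuous_swap).isLocallyClosed]
  intro K hKU hK
  have hswap : Prod.swap ⁻¹' (Prod.swap ⁻¹' K) = K := rfl
  rw [← hswap, measurePreserving_swap_real.integrableOn_comp_preimage measurableEmbedding_swap_real]
  rw [locallyIntegrableOn_iff hU.isLocallyClosed] at hf
  exact hf _ (fun p hp => hKU hp) ((Homeomorph.prodComm ℝ ℝ).isCompact_preimage.2 hK)

theorem isWeakDeriv_iff {U : Set (ℝ × ℝ)} {e : ℝ × ℝ} {f u : ℝ × ℝ → ℝ} :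
    IsWeakDeriv U e f u ↔ LocallyIntegrableOn f U ∧ LocallyIntegrableOn u U ∧
      ∀ ψ, IsTestFunction U ψ → ∫ p, f p * fderiv ℝ ψ p e = -∫ p, u p * ψ p := by
  refine and_congr_right fun _ => and_congr_right fun _ =>
    ⟨fun h ψ hψ => ?_, fun h ψ hψ hψc hψU => ?_⟩
  · rw [← (hψ.fderiv_apply e).setIntegral_mul_eq_integral, ← hψ.setIntegral_mul_eq_integral]
    exact h ψ hψ.contDiff hψ.hasCompactSupport hψ.tsupport_subset
  · have hψ' : IsTestFunction U ψ := ⟨hψ, hψc, hψU⟩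
    rw [(hψ'.fderiv_apply e).setIntegral_mul_eq_integral, hψ'.setIntegral_mul_eq_integral]
    exact h ψ hψ'

namespace IsWeakDeriv

variable {U V : Set (ℝ × ℝ)} {e : ℝ × ℝ} {f g u : ℝ × ℝ → ℝ}

theorem mono (hVU : V ⊆ U) (h : IsWeakDeriv U e f u) : IsWeakDeriv V e f u := by
  rw [isWeakDeriv_iff] at h ⊢
  exact ⟨h.1.mono_set hVU, h.2.1.mono_set hVU, fun ψ hψ =>
    h.2.2 ψ ⟨hψ.contDiff, hψ.hasCompactSupport, hψ.tsupport_subset.trans hVU⟩⟩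

theorem congr (hfg : EqOn f g U) (hU : MeasurableSet U) (h : IsWeakDeriv U e f u) :
    IsWeakDeriv U e g u := by
  refine ⟨fun p hp => ?_, h.2.1, fun ψ hψ hψc hψU => ?_⟩
  · obtain ⟨s, hs, hfs⟩ := h.1 p hp
    exact ⟨s ∩ U, inter_mem hs self_mem_nhdsWithin, (hfs.mono_set inter_subset_left).congr_fun_ae
      (ae_restrict_of_ae_restrict_of_subset inter_subset_right
        ((ae_restrict_iff' hU).2 (Eventually.of_forall hfg)))⟩
  · rw [← h.2.2 ψ hψ hψc hψU]
    exact setIntegral_congr_fun hU fun p hp => by simp only [hfg hp]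

theorem comp_swap (hU : IsOpen U) (h : IsWeakDeriv U e f u) :
    IsWeakDeriv (Prod.swap ⁻¹' U) e.swap (f ∘ Prod.swap) (u ∘ Prod.swap) := by
  rw [isWeakDeriv_iff] at h ⊢
  refine ⟨locallyIntegrableOn_comp_swap hU h.1, locallyIntegrableOn_comp_swap hU h.2.1,
    fun ψ hψ => ?_⟩
  have hψ' : IsTestFunction U (ψ ∘ Prod.swap) :=
    { contDiff := hψ.contDiff.comp (contDiff_snd.prodMk contDiff_fst)
      hasCompactSupport := hψ.hasCompactSupport.comp_homeomorph (Homeomorph.prodComm ℝ ℝ)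
      tsupport_subset := (tsupport_comp_subset_preimage ψ continuous_swap).trans
        fun p hp => hψ.tsupport_subset hp }
  have hderiv : ∀ p, fderiv ℝ (ψ ∘ Prod.swap) p e = fderiv ℝ ψ p.swap e.swap := fun p => by
    rw [show (Prod.swap : ℝ × ℝ → ℝ × ℝ) = ContinuousLinearEquiv.prodComm ℝ ℝ ℝ from rfl,
      ContinuousLinearEquiv.comp_right_fderiv]
    rfl
  have hcomp := fun F : ℝ × ℝ → ℝ =>
    measurePreserving_swap_real.integral_comp measurableEmbedding_swap_real F
  rw [← hcomp, ← hcomp fun p => (u ∘ Prod.swap) p * ψ p]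
  simpa only [Function.comp_apply, Prod.swap_swap, hderiv] using h.2.2 _ hψ'

end IsWeakDeriv

/-! ### Absolute continuity on lines -/

theorem IsTestFunction.mul_prod {E F : Type*} [NormedAddCommGroup E] [NormedSpace ℝ E]
    [NormedAddCommGroup F] [NormedSpace ℝ F] {A : Set E} {B : Set F} {χ : E → ℝ} {θ : F → ℝ}
    (hχ : IsTestFunction A χ) (hθ : IsTestFunction B θ) :
    IsTestFunction (A ×ˢ B) fun p => χ p.1 * θ p.2 := by
  have hsupp : Function.support (fun p : E × F => χ p.1 * θ p.2) ⊆ tsupport χ ×ˢ tsupport θ :=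
    fun p hp => ⟨subset_tsupport _ (left_ne_zero_of_mul hp),
      subset_tsupport _ (right_ne_zero_of_mul hp)⟩
  exact ⟨(hχ.contDiff.comp contDiff_fst).mul (hθ.contDiff.comp contDiff_snd),
    HasCompactSupport.of_support_subset_isCompact
      (hχ.hasCompactSupport.isCompact.prod hθ.hasCompactSupport.isCompact) hsupp,
    (closure_minimal hsupp ((isClosed_tsupport _).prod (isClosed_tsupport _))).trans
      (prod_mono hχ.tsupport_subset hθ.tsupport_subset)⟩

section Product

variable {A B : Set ℝ} {u : ℝ × ℝ → ℝ} {χ θ : ℝ → ℝ}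

theorem IsTestFunction.integrableOn_mul_snd (hθ : IsTestFunction B θ)
    (hu : IntegrableOn u (A ×ˢ B)) : IntegrableOn (fun p => u p * θ p.2) (A ×ˢ B) := by
  obtain ⟨C, hC⟩ := hθ.hasCompactSupport.exists_bound_of_continuous hθ.continuous
  exact Integrable.mul_bdd (c := C) hu (hθ.continuous.comp continuous_snd).aestronglyMeasurable
    (Eventually.of_forall fun p => hC p.2)

theorem integral_mul_mul_prod (hχ : IsTestFunction A χ) (hθ : IsTestFunction B θ)
    (hu : IntegrableOn u (A ×ˢ B)) :
    ∫ p, u p * (χ p.1 * θ p.2) = ∫ x in A, (∫ y in B, u (x, y) * θ y) * χ x := by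
  have hψ := hχ.mul_prod hθ
  rw [← hψ.setIntegral_mul_eq_integral, Measure.volume_eq_prod,
    setIntegral_prod _ (hψ.integrableOn_mul hu)]
  simp_rw [← integral_mul_const, mul_assoc, mul_comm (χ _)]

theorem fderiv_mul_prod_apply (hχ : Differentiable ℝ χ) (hθ : Differentiable ℝ θ) (p : ℝ × ℝ) :
    fderiv ℝ (fun p : ℝ × ℝ => χ p.1 * θ p.2) p (1, 0) = deriv χ p.1 * θ p.2 := by
  have hdiff : DifferentiableAt ℝ (fun p : ℝ × ℝ => χ p.1 * θ p.2) p := by fun_prop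
  rw [← hdiff.lineDeriv_eq_fderiv, lineDeriv]
  simp [deriv_comp_const_add]

end Product

section Rectangle

variable {a b c d : ℝ} {f u : ℝ × ℝ → ℝ}

/-- The function `f` is absolutely continuous on almost every horizontal line of the rectangle
`I × J`, with derivative `u`. The corresponding property of the vertical lines is
`IsACL (f ∘ Prod.swap) (v ∘ Prod.swap) J I`. -/
def IsACL (f u : ℝ × ℝ → ℝ) (I J : Set ℝ) : Prop :=
  IntegrableOn u (I ×ˢ J) ∧
    ∀ᵐ y ∂volume.restrict J, IsPrimitiveOn (fun x => f (x, y)) (fun x => u (x, y)) I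

theorem IsWeakDeriv.isPrimitiveOn_integral_mul
    (h : IsWeakDeriv (Ioo a b ×ˢ Ioo c d) (1, 0) f u) (hf : Continuous f)
    (hu : IntegrableOn u (Ioo a b ×ˢ Ioo c d)) {θ : ℝ → ℝ} (hθ : IsTestFunction (Ioo c d) θ) :
    IsPrimitiveOn (fun x => ∫ y in Ioo c d, f (x, y) * θ y)
      (fun x => ∫ y in Ioo c d, u (x, y) * θ y) (Icc a b) := by
  have hθc := hθ.continuous
  have hfi : IntegrableOn f (Ioo a b ×ˢ Ioo c d) :=
    (hf.continuousOn.integrableOn_compact (isCompact_Icc.prod isCompact_Icc)).mono_set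
      (prod_mono Ioo_subset_Icc_self Ioo_subset_Icc_self)
  refine isPrimitiveOn_of_integral_mul_deriv_eq (Continuous.continuousOn ?_) ?_ fun χ hχ => ?_
  · simp_rw [← integral_Icc_eq_integral_Ioo]
    exact continuous_parametric_integral_of_continuous (by fun_prop) isCompact_Icc
  · have hi := hθ.integrableOn_mul_snd hu
    rw [IntegrableOn, Measure.volume_eq_prod, ← Measure.prod_restrict] at hi
    exact hi.integral_prod_left
  · rw [← integral_mul_mul_prod hχ.deriv hθ hfi, ← integral_mul_mul_prod hχ hθ hu,
      ← (isWeakDeriv_iff.1 h).2.2 _ (hχ.mul_prod hθ)]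
    simp_rw [fderiv_mul_prod_apply (hχ.contDiff.differentiable (by simp))
      (hθ.contDiff.differentiable (by simp))]

theorem IsWeakDeriv.ae_sub_eq_integral (h : IsWeakDeriv (Ioo a b ×ˢ Ioo c d) (1, 0) f u)
    (hf : Continuous f) (hu : IntegrableOn u (Icc a b ×ˢ Icc c d)) {s t : ℝ} (hs : s ∈ Icc a b)
    (ht : t ∈ Icc a b) :
    ∀ᵐ y ∂volume.restrict (Icc c d), f (t, y) - f (s, y) = ∫ x in s..t, u (x, y) := by
  have hst : Ι s t ⊆ Icc a b := uIoc_subset_uIcc.trans (uIcc_subset_Icc hs ht)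
  have hu' := hu.mono_set (prod_mono Ioo_subset_Icc_self Ioo_subset_Icc_self)
  have hust : IntegrableOn u (Ι s t ×ˢ Ioo c d) :=
    hu.mono_set (prod_mono hst Ioo_subset_Icc_self)
  have hfi : ∀ x, IntegrableOn (fun y => f (x, y)) (Ioo c d) := fun x =>
    ((hf.comp (by fun_prop : Continuous (Prod.mk x))).continuousOn.integrableOn_Icc).mono_set
      Ioo_subset_Icc_self
  have hEi : IntegrableOn (fun y => ∫ x in s..t, u (x, y)) (Ioo c d) := by
    rw [IntegrableOn, Measure.volume_eq_prod, ← Measure.prod_restrict] at hust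
    simp_rw [intervalIntegral.intervalIntegral_eq_integral_uIoc]
    exact hust.integral_prod_right.smul (_ : ℝ)
  rw [← restrict_Ioo_eq_restrict_Icc, ae_restrict_iff' measurableSet_Ioo]
  simp_rw [← sub_eq_zero (a := f _ - f _)]
  refine isOpen_Ioo.ae_eq_zero_of_integral_contDiff_smul_eq_zero
    (((hfi t).sub (hfi s)).sub hEi).locallyIntegrableOn fun θ hθ hθc hθs => ?_
  have hθ' : IsTestFunction (Ioo c d) θ := ⟨hθ, hθc, hθs⟩
  have hfubini : ∫ x in s..t, ∫ y in Ioo c d, u (x, y) * θ y =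
      ∫ y in Ioo c d, (∫ x in s..t, u (x, y)) * θ y := by
    simp_rw [← intervalIntegral.integral_mul_const]
    refine intervalIntegral_integral_swap ?_
    rw [Measure.prod_restrict]
    exact hθ'.integrableOn_mul_snd hust
  simp_rw [smul_eq_mul, mul_comm (θ _)]
  rw [← hθ'.setIntegral_mul_eq_integral]
  simp_rw [sub_mul]
  rw [integral_sub, integral_sub (hθ'.integrableOn_mul (hfi t)) (hθ'.integrableOn_mul (hfi s)),
    ← hfubini, (h.isPrimitiveOn_integral_mul hf hu' hθ').2 s hs t ht, sub_self]
  · exact (hθ'.integrableOn_mul (hfi t)).sub (hθ'.integrableOn_mul (hfi s))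
  · exact hθ'.integrableOn_mul hEi

theorem ae_integrableOn_section {I J : Set ℝ} (hu : IntegrableOn u (I ×ˢ J)) :
    ∀ᵐ y ∂volume.restrict J, IntegrableOn (fun x => u (x, y)) I := by
  rw [IntegrableOn, Measure.volume_eq_prod, ← Measure.prod_restrict] at hu
  exact hu.prod_left_ae

theorem IsWeakDeriv.isACL_of_continuous (h : IsWeakDeriv (Ioo a b ×ˢ Ioo c d) (1, 0) f u)
    (hf : Continuous f) (hu : IntegrableOn u (Icc a b ×ˢ Icc c d)) :
    IsACL f u (Icc a b) (Icc c d) := by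
  refine ⟨hu, ?_⟩
  rcases lt_or_ge b a with hab | hab
  · simp [hab, IsPrimitiveOn]
  obtain ⟨D, hDc, hD⟩ := TopologicalSpace.exists_countable_dense (Icc a b)
  have hae : ∀ᵐ y ∂volume.restrict (Icc c d), ∀ t ∈ D,
      f (t, y) - f (a, y) = ∫ x in a..t, u (x, y) :=
    (ae_ball_iff hDc).2 fun t _ => h.ae_sub_eq_integral hf hu (left_mem_Icc.2 hab) t.2
  filter_upwards [hae, ae_integrableOn_section hu] with y hy huy
  rw [← uIcc_of_le hab] at huy ⊢
  refine isPrimitiveOn_uIcc_of_left huy fun x hx => ?_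
  have hint : Continuous fun t : Icc a b => ∫ x in a..t, u (x, y) :=
    continuousOn_iff_continuous_domRestrict.1
      (uIcc_of_le hab ▸ intervalIntegral.continuousOn_primitive_interval huy)
  exact congr_fun (Continuous.ext_on hD (by fun_prop) hint hy) ⟨x, uIcc_of_le hab ▸ hx⟩

theorem IsACL.congr {g : ℝ × ℝ → ℝ} {I J : Set ℝ} (hJ : MeasurableSet J)
    (hfg : EqOn f g (I ×ˢ J)) (h : IsACL f u I J) : IsACL g u I J := by
  refine ⟨h.1, ?_⟩
  filter_upwards [h.2, ae_restrict_mem hJ] with y hy hyJ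
  refine ⟨hy.1, fun s hs t ht => ?_⟩
  dsimp only
  rw [← hfg (mk_mem_prod hs hyJ), ← hfg (mk_mem_prod ht hyJ)]
  exact hy.2 s hs t ht

theorem exists_continuous_eqOn_of_isCompact {K : Set (ℝ × ℝ)} (hK : IsCompact K)
    (hf : ContinuousOn f K) : ∃ f' : ℝ × ℝ → ℝ, Continuous f' ∧ EqOn f' f K := by
  obtain ⟨f', hf'⟩ := ContinuousMap.exists_restrict_eq hK.isClosed ⟨_, hf.domRestrict⟩
  exact ⟨f', f'.continuous, fun p hp => DFunLike.congr_fun hf' ⟨p, hp⟩⟩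

theorem IsWeakDeriv.isACL {U : Set (ℝ × ℝ)} (h : IsWeakDeriv U (1, 0) f u) (hf : ContinuousOn f U)
    (hU : [[a, b]] ×ˢ [[c, d]] ⊆ U) : IsACL f u [[a, b]] [[c, d]] := by
  have hK : IsCompact ([[a, b]] ×ˢ [[c, d]]) := isCompact_uIcc.prod isCompact_uIcc
  obtain ⟨f', hf', hff'⟩ := exists_continuous_eqOn_of_isCompact hK (hf.mono hU)
  have hIoo : Ioo (min a b) (max a b) ×ˢ Ioo (min c d) (max c d) ⊆ [[a, b]] ×ˢ [[c, d]] :=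
    prod_mono Ioo_subset_Icc_self Ioo_subset_Icc_self
  have h' : IsWeakDeriv _ (1, 0) f' u := (h.mono (hIoo.trans hU)).congr
    (fun p hp => (hff' (hIoo hp)).symm) (measurableSet_Ioo.prod measurableSet_Ioo)
  exact (h'.isACL_of_continuous hf' (h.2.1.mono_set hU |>.integrableOn_isCompact hK)).congr
    measurableSet_Icc hff'

end Rectangle

theorem ae_eq_prod_of_ae_ae_eq {E F : Type*} [MeasurableSpace E] [MeasurableSpace F]
    {μ : Measure E} {ν : Measure F} [SFinite μ] [SFinite ν] {f g : E × F → ℝ}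
    (hf : AEMeasurable f (μ.prod ν)) (hg : AEMeasurable g (μ.prod ν))
    (h : ∀ᵐ y ∂ν, ∀ᵐ x ∂μ, f (x, y) = g (x, y)) : f =ᵐ[μ.prod ν] g := by
  have hfg : AEMeasurable (fun p => edist (f p) (g p)) (μ.prod ν) := hf.edist hg
  have hzero : ∫⁻ p, edist (f p) (g p) ∂μ.prod ν = 0 := by
    rw [lintegral_prod_symm _ hfg]
    refine lintegral_eq_zero_of_ae_eq_zero (h.mono fun y hy => ?_)
    exact lintegral_eq_zero_of_ae_eq_zero (hy.mono fun x hx => by simp [hx])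
  exact ((lintegral_eq_zero_iff' hfg).1 hzero).mono fun p hp => edist_eq_zero.1 hp

theorem ae_restrict_prod_of_swap {I J : Set ℝ} {P : ℝ × ℝ → Prop}
    (h : ∀ᵐ p ∂volume.restrict (J ×ˢ I), P p.swap) : ∀ᵐ p ∂volume.restrict (I ×ˢ J), P p := by
  rw [Measure.volume_eq_prod, ← Measure.prod_restrict] at h ⊢
  exact Measure.measurePreserving_swap.quasiMeasurePreserving.ae h

theorem countable_eq_zero_and_deriv_ne_zero (F : ℝ → ℝ) :
    {x | F x = 0 ∧ deriv F x ≠ 0}.Countable := by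
  refine (countable_setOfPred_isolated_right_within (s := {x | F x = 0})).mono ?_
  rintro x ⟨hx, hd⟩
  refine ⟨hx, empty_mem_iff_bot.1 ?_⟩
  have hne := (differentiableAt_of_deriv_ne_zero hd).hasDerivAt.eventually_ne (c := 0) hd
  filter_upwards [hne.filter_mono (nhdsWithin_mono _ fun z hz => ne_of_gt hz.2),
    self_mem_nhdsWithin] with z hz hz' using hz hz'.1

theorem X_congr {f g : ℝ × ℝ → ℝ} {p : ℝ × ℝ} (h : f =ᶠ[𝓝 p] g) : X f p = X g p :=
  EventuallyEq.deriv_eq ((Continuous.prodMk_left p.2).continuousAt.eventually h)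

theorem measurable_X {f : ℝ × ℝ → ℝ} (hf : Continuous f) : Measurable (X f) :=
  (measurable_deriv_with_param (f := fun y x => f (x, y)) (hf.comp continuous_swap)).comp
    measurable_swap

namespace IsACL

variable {a b c d : ℝ} {f u : ℝ × ℝ → ℝ}

theorem comp {S : ℝ → ℝ} {J : Set ℝ} (hS : ContDiff ℝ 1 S)
    (hf : ContinuousOn f ([[a, b]] ×ˢ J)) (hJ : IsCompact J) (h : IsACL f u [[a, b]] J) :
    IsACL (S ∘ f) (fun p => deriv S (f p) * u p) [[a, b]] J :=
  ⟨h.1.continuousOn_mul ((hS.continuous_deriv le_rfl).comp_continuousOn hf)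
    (isCompact_uIcc.prod hJ), h.2.mono fun _ hy => hy.comp hS⟩

theorem ae_hasDerivAt {J : Set ℝ} (h : IsACL f u [[a, b]] J) :
    ∀ᵐ y ∂volume.restrict J, ∀ᵐ x ∂volume.restrict [[a, b]],
      HasDerivAt (fun t => f (t, y)) (u (x, y)) x :=
  h.2.mono fun _ hy => (isPrimitiveOn_uIcc_iff.1 hy).2

theorem aemeasurable {I J : Set ℝ} (h : IsACL f u I J) :
    AEMeasurable u ((volume.restrict I).prod (volume.restrict J)) := by
  rw [Measure.prod_restrict]
  exact h.1.aemeasurable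

theorem ae_X_eq (hf : ContinuousOn f ([[a, b]] ×ˢ [[c, d]])) (h : IsACL f u [[a, b]] [[c, d]]) :
    ∀ᵐ p ∂volume.restrict ([[a, b]] ×ˢ [[c, d]]), X f p = u p := by
  obtain ⟨f', hf', hff'⟩ :=
    exists_continuous_eqOn_of_isCompact (isCompact_uIcc.prod isCompact_uIcc) hf
  have hX : X f' =ᵐ[(volume.restrict [[a, b]]).prod (volume.restrict [[c, d]])] u := by
    refine ae_eq_prod_of_ae_ae_eq (measurable_X hf').aemeasurable h.aemeasurable ?_
    filter_upwards [(h.congr measurableSet_Icc hff'.symm).ae_hasDerivAt] with y hy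
    exact hy.mono fun x hx => hx.deriv
  simp_rw [uIcc, ← restrict_Ioo_eq_restrict_Icc, Measure.prod_restrict] at hX
  rw [uIcc, uIcc, Measure.volume_eq_prod, ← Measure.prod_restrict, ← restrict_Ioo_eq_restrict_Icc,
    ← restrict_Ioo_eq_restrict_Icc, Measure.prod_restrict]
  filter_upwards [hX, ae_restrict_mem (measurableSet_Ioo.prod measurableSet_Ioo)] with p hp hmem
  rw [← hp]
  refine X_congr (Filter.mem_of_superset ((isOpen_Ioo.prod isOpen_Ioo).mem_nhds hmem) ?_)
  exact fun q hq => (hff' (prod_mono Ioo_subset_Icc_self Ioo_subset_Icc_self hq)).symm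

theorem ae_eq_zero_of_eq_zero (hf : ContinuousOn f ([[a, b]] ×ˢ [[c, d]]))
    (h : IsACL f u [[a, b]] [[c, d]]) :
    ∀ᵐ p ∂volume.restrict ([[a, b]] ×ˢ [[c, d]]), f p = 0 → u p = 0 := by
  have hfm := hf.aemeasurable (μ := volume) (measurableSet_Icc.prod measurableSet_Icc)
  have hind : (f ⁻¹' {0}).indicator u =ᵐ[(volume.restrict [[a, b]]).prod
      (volume.restrict [[c, d]])] 0 := by
    refine ae_eq_prod_of_ae_ae_eq ?_ aemeasurable_const ?_
    · rw [Measure.prod_restrict]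
      exact h.1.aemeasurable.indicator₀ (hfm.nullMeasurableSet_preimage (measurableSet_singleton 0))
    filter_upwards [h.ae_hasDerivAt] with y hy
    filter_upwards [hy, ((countable_eq_zero_and_deriv_ne_zero fun x => f (x, y)).ae_notMem volume
      |> ae_restrict_of_ae)] with x hx hx0
    refine indicator_apply_eq_zero.2 fun hfx => ?_
    by_contra hne
    exact hx0 ⟨hfx, by rwa [hx.deriv]⟩
  rw [Measure.prod_restrict] at hind
  exact hind.mono fun p hp hp0 => indicator_apply_eq_zero.1 hp hp0

/-- Both sides are the integral over the rectangle of the common function in `hAB`. -/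
theorem integral_mul_sub_eq_integral_sub {A Ay B Bx : ℝ × ℝ → ℝ} {w : ℝ → ℝ}
    (hA : IsACL (A ∘ Prod.swap) (Ay ∘ Prod.swap) [[c, d]] [[a, b]])
    (hB : IsACL B Bx [[a, b]] [[c, d]])
    (hAB : ∀ᵐ p ∂volume.restrict ([[a, b]] ×ˢ [[c, d]]), w p.1 * Ay p = Bx p) :
    ∫ x in a..b, w x * (A (x, d) - A (x, c)) = ∫ y in c..d, (B (b, y) - B (a, y)) := by
  rw [Measure.volume_eq_prod, ← Measure.prod_restrict] at hAB
  have hAB' := ae_restrict_of_ae_restrict_of_subset uIoc_subset_uIcc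
    ((Measure.ae_ae_of_ae_prod hAB).mono fun x hx =>
      ae_restrict_of_ae_restrict_of_subset (uIoc_subset_uIcc (a := c) (b := d)) hx)
  calc ∫ x in a..b, w x * (A (x, d) - A (x, c))
      = ∫ x in a..b, ∫ y in c..d, Bx (x, y) := by
        refine intervalIntegral.integral_congr_ae_restrict ?_
        filter_upwards [ae_restrict_of_ae_restrict_of_subset uIoc_subset_uIcc hA.2, hAB']
          with x hx hx'
        have hxA : A (x, d) - A (x, c) = ∫ y in c..d, Ay (x, y) :=
          hx.2 c left_mem_uIcc d right_mem_uIcc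
        rw [hxA, ← intervalIntegral.integral_const_mul]
        exact intervalIntegral.integral_congr_ae_restrict hx'
    _ = ∫ y in c..d, ∫ x in a..b, Bx (x, y) :=
        intervalIntegral_intervalIntegral_swap (F := fun x y => Bx (x, y))
          (hB.1.mono_set (prod_mono uIoc_subset_uIcc uIoc_subset_uIcc))
    _ = ∫ y in c..d, (B (b, y) - B (a, y)) := by
        refine intervalIntegral.integral_congr_ae_restrict ?_
        filter_upwards [ae_restrict_of_ae_restrict_of_subset uIoc_subset_uIcc hB.2] with y hy
        exact (hy.2 a left_mem_uIcc b right_mem_uIcc).symm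

end IsACL

/-- The functions `u` and `v` are the partial derivatives of `f` on the rectangle `I × J`, and `f`
is absolutely continuous on almost every horizontal and almost every vertical line. -/
structure HasACLGradient (f u v : ℝ × ℝ → ℝ) (I J : Set ℝ) : Prop where
  fst : IsACL f u I J
  snd : IsACL (f ∘ Prod.swap) (v ∘ Prod.swap) J I

namespace HasACLGradient

variable {a b c d : ℝ} {f u v : ℝ × ℝ → ℝ}

theorem comp {S : ℝ → ℝ} (hS : ContDiff ℝ 1 S) (hf : ContinuousOn f ([[a, b]] ×ˢ [[c, d]]))
    (h : HasACLGradient f u v [[a, b]] [[c, d]]) :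
    HasACLGradient (S ∘ f) (fun p => deriv S (f p) * u p) (fun p => deriv S (f p) * v p)
      [[a, b]] [[c, d]] where
  fst := h.fst.comp hS hf isCompact_uIcc
  snd := h.snd.comp hS (hf.comp continuous_swap.continuousOn fun _ hp => hp.symm) isCompact_uIcc

theorem ae_partials_eq (hf : ContinuousOn f ([[a, b]] ×ˢ [[c, d]]))
    (h : HasACLGradient f u v [[a, b]] [[c, d]]) :
    ∀ᵐ p ∂volume.restrict ([[a, b]] ×ˢ [[c, d]]),
      X f p = u p ∧ deriv (fun t => f (p.1, t)) p.2 = v p :=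
  (h.fst.ae_X_eq hf).and (ae_restrict_prod_of_swap
    (h.snd.ae_X_eq (hf.comp continuous_swap.continuousOn fun _ hp => hp.symm)))

theorem ae_eq_zero_of_eq_zero (hf : ContinuousOn f ([[a, b]] ×ˢ [[c, d]]))
    (h : HasACLGradient f u v [[a, b]] [[c, d]]) :
    ∀ᵐ p ∂volume.restrict ([[a, b]] ×ˢ [[c, d]]), f p = 0 → u p = 0 ∧ v p = 0 := by
  have hv := ae_restrict_prod_of_swap (P := fun p => f p = 0 → v p = 0) (h.snd.ae_eq_zero_of_eq_zero
    (hf.comp continuous_swap.continuousOn fun _ hp => hp.symm))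
  filter_upwards [h.fst.ae_eq_zero_of_eq_zero hf, hv] with p hu hv h0 using ⟨hu h0, hv h0⟩

end HasACLGradient

theorem MemHW.exists_hasACLGradient {α : ℝ} {r : ENNReal} {U : Set (ℝ × ℝ)} {f : ℝ × ℝ → ℝ}
    (h : MemHW α r U f) (hU : IsOpen U) (hf : ContinuousOn f U) :
    ∃ u v, ∀ ⦃a b c d : ℝ⦄, [[a, b]] ×ˢ [[c, d]] ⊆ U → HasACLGradient f u v [[a, b]] [[c, d]] := by
  obtain ⟨-, u, v, hu, hv, -, -⟩ := h
  refine ⟨u, v, fun a b c d hR => ⟨hu.isACL hf hR, (hv.comp_swap hU).isACL ?_ ?_⟩⟩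
  · exact hf.comp continuous_swap.continuousOn fun _ hp => hp
  · exact fun p hp => hR hp.symm

/-! ### The Meyerson map and the Cauchy-Riemann equations -/

section CauchyRiemann

variable {α : ℝ}

theorem continuous_abs_rpow (hα : 0 < α) : Continuous fun x : ℝ => |x| ^ α :=
  continuous_abs.rpow_const fun _ => Or.inr hα.le

theorem hasDerivAt_stretch (hα : 0 < α) (x : ℝ) : HasDerivAt (stretch α) (|x| ^ α) x := by
  have hne : ∀ y ≠ (0 : ℝ), HasDerivAt (stretch α) (|y| ^ α) y := fun y hy => by
    have h := ((hasDerivAt_id y).mul ((hasDerivAt_abs hy).rpow_const (p := α)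
      (Or.inl (abs_ne_zero.2 hy)))).div_const (α + 1)
    convert! h using 1
    have hsign : y * (SignType.sign y : ℝ) = |y| := by rw [mul_comm, sign_mul_self]
    have hy' : |y| ≠ 0 := abs_ne_zero.2 hy
    rw [Real.rpow_sub_one hy', id, ← mul_assoc, ← mul_assoc, hsign]
    field_simp
    ring
  rcases eq_or_ne x 0 with rfl | hx
  · exact hasDerivAt_of_hasDerivAt_of_ne hne (continuous_stretch hα).continuousAt
      (continuous_abs_rpow hα).continuousAt
  · exact hne x hx

theorem deriv_stretch (hα : 0 < α) : deriv (stretch α) = fun x => |x| ^ α :=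
  funext fun x => (hasDerivAt_stretch hα x).deriv

theorem contDiff_one_stretch (hα : 0 < α) : ContDiff ℝ 1 (stretch α) := by
  rw [contDiff_one_iff_deriv, deriv_stretch hα]
  exact ⟨fun x => (hasDerivAt_stretch hα x).differentiableAt, continuous_abs_rpow hα⟩

theorem monotone_stretch (hα : 0 < α) : Monotone (stretch α) :=
  monotone_of_hasDerivAt_nonneg (hasDerivAt_stretch hα) fun x => by positivity

theorem meyerson_eq (hα : 0 < α) (x y : ℝ) :
    meyerson α hα (x, y) = (stretch α x : ℂ) + y * Complex.I :=
  Complex.mk_eq_add_mul_I _ _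

theorem meyerson_image_rectangle_subset (hα : 0 < α) (x₁ x₂ y₁ y₂ : ℝ) :
    meyerson α hα '' ([[x₁, x₂]] ×ˢ [[y₁, y₂]]) ⊆
      Complex.Rectangle (meyerson α hα (x₁, y₁)) (meyerson α hα (x₂, y₂)) := by
  rintro _ ⟨⟨x, y⟩, ⟨hx, hy⟩, rfl⟩
  exact ⟨(monotone_stretch hα).image_uIcc_subset (mem_image_of_mem _ hx), hy⟩

theorem integral_stretch_eq (hα : 0 < α) {F : ℂ → ℂ} {x₁ x₂ y : ℝ}
    (hF : ContinuousOn F (meyerson α hα '' ([[x₁, x₂]] ×ˢ {y}))) :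
    ∫ x in stretch α x₁..stretch α x₂, F (x + y * Complex.I) =
      ∫ x in x₁..x₂, |x| ^ α • F (meyerson α hα (x, y)) := by
  rw [← intervalIntegral.integral_deriv_smul_comp' (fun x _ => hasDerivAt_stretch hα x)
    (continuous_abs_rpow hα).continuousOn]
  · simp_rw [Function.comp_apply, meyerson_eq]
  · refine hF.comp (by fun_prop) ?_
    rintro _ ⟨x, hx, rfl⟩
    exact ⟨(x, y), ⟨hx, rfl⟩, meyerson_eq hα x y⟩

section Rectangle

variable {F : ℂ → ℂ} {x₁ x₂ y₁ y₂ : ℝ}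

theorem intervalIntegrable_rpow_smul_meyerson (hα : 0 < α)
    (hF : ContinuousOn F (meyerson α hα '' ([[x₁, x₂]] ×ˢ [[y₁, y₂]]))) {y : ℝ}
    (hy : y ∈ [[y₁, y₂]]) :
    IntervalIntegrable (fun x => |x| ^ α • F (meyerson α hα (x, y))) volume x₁ x₂ := by
  refine ((continuous_abs_rpow hα).continuousOn.smul (hF.comp ?_ ?_)).intervalIntegrable
  · exact ((meyerson α hα).continuous.comp (Continuous.prodMk_left y)).continuousOn
  · exact fun x hx => mem_image_of_mem _ ⟨hx, hy⟩

theorem intervalIntegrable_meyerson (hα : 0 < α)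
    (hF : ContinuousOn F (meyerson α hα '' ([[x₁, x₂]] ×ˢ [[y₁, y₂]]))) {x : ℝ}
    (hx : x ∈ [[x₁, x₂]]) :
    IntervalIntegrable (fun y => F (meyerson α hα (x, y))) volume y₁ y₂ := by
  refine (hF.comp ?_ ?_).intervalIntegrable
  · exact ((meyerson α hα).continuous.comp (Continuous.prodMk_right x)).continuousOn
  · exact fun y hy => mem_image_of_mem _ ⟨hx, hy⟩

theorem wedgeIntegral_add_wedgeIntegral_meyerson (hα : 0 < α)
    (hF : ContinuousOn F (meyerson α hα '' ([[x₁, x₂]] ×ˢ [[y₁, y₂]]))) :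
    Complex.wedgeIntegral (meyerson α hα (x₁, y₁)) (meyerson α hα (x₂, y₂)) F +
        Complex.wedgeIntegral (meyerson α hα (x₂, y₂)) (meyerson α hα (x₁, y₁)) F =
      Complex.I * (∫ y in y₁..y₂, (F (meyerson α hα (x₂, y)) - F (meyerson α hα (x₁, y)))) -
        ∫ x in x₁..x₂, |x| ^ α • (F (meyerson α hα (x, y₂)) - F (meyerson α hα (x, y₁))) := by
  have hF' : ∀ y ∈ [[y₁, y₂]], ContinuousOn F (meyerson α hα '' ([[x₁, x₂]] ×ˢ {y})) :=
    fun y hy => hF.mono (image_mono (prod_mono_right (singleton_subset_iff.2 hy)))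
  simp_rw [smul_sub]
  rw [Complex.wedgeIntegral_add_wedgeIntegral_eq,
    intervalIntegral.integral_sub (intervalIntegrable_rpow_smul_meyerson hα hF right_mem_uIcc)
      (intervalIntegrable_rpow_smul_meyerson hα hF left_mem_uIcc),
    intervalIntegral.integral_sub (intervalIntegrable_meyerson hα hF right_mem_uIcc)
      (intervalIntegrable_meyerson hα hF left_mem_uIcc),
    ← integral_stretch_eq hα (hF' y₁ left_mem_uIcc),
    ← integral_stretch_eq hα (hF' y₂ right_mem_uIcc)]
  simp only [meyerson_eq hα, Complex.add_re, Complex.add_im, Complex.ofReal_re, Complex.ofReal_im,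
    Complex.re_ofReal_mul, Complex.im_ofReal_mul, Complex.I_re, Complex.I_im, mul_zero, mul_one,
    add_zero, zero_add, smul_eq_mul]
  ring

theorem wedgeIntegral_add_wedgeIntegral_eq_zero (hα : 0 < α) {ux uy vx vy : ℝ × ℝ → ℝ}
    (hF : ContinuousOn F (meyerson α hα '' ([[x₁, x₂]] ×ˢ [[y₁, y₂]])))
    (hu : HasACLGradient (fun p => (F (meyerson α hα p)).re) ux uy [[x₁, x₂]] [[y₁, y₂]])
    (hv : HasACLGradient (fun p => (F (meyerson α hα p)).im) vx vy [[x₁, x₂]] [[y₁, y₂]])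
    (huv : ∀ᵐ p ∂volume.restrict ([[x₁, x₂]] ×ˢ [[y₁, y₂]]),
      |p.1| ^ α * vy p = ux p ∧ |p.1| ^ α * uy p = -vx p) :
    Complex.wedgeIntegral (meyerson α hα (x₁, y₁)) (meyerson α hα (x₂, y₂)) F +
      Complex.wedgeIntegral (meyerson α hα (x₂, y₂)) (meyerson α hα (x₁, y₁)) F = 0 := by
  have green_re := hv.snd.integral_mul_sub_eq_integral_sub
    (A := fun p => (F (meyerson α hα p)).im) (w := fun x => |x| ^ α) hu.fst
    (huv.mono fun p hp => hp.1)
  have green_im := hu.snd.integral_mul_sub_eq_integral_sub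
    (A := fun p => (F (meyerson α hα p)).re) (w := fun x => -|x| ^ α) hv.fst
    (huv.mono fun p hp => by rw [neg_mul, hp.2, neg_neg])
  have hver := (intervalIntegrable_meyerson hα hF right_mem_uIcc).sub
    (intervalIntegrable_meyerson hα hF left_mem_uIcc)
  have hhor := (intervalIntegrable_rpow_smul_meyerson hα hF right_mem_uIcc).sub
    (intervalIntegrable_rpow_smul_meyerson hα hF left_mem_uIcc)
  simp only [neg_mul, intervalIntegral.integral_neg] at green_im
  simp_rw [wedgeIntegral_add_wedgeIntegral_meyerson hα hF, smul_sub]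
  apply Complex.ext
  · have hre := Complex.reCLM.intervalIntegral_comp_comm hhor
    have him := Complex.imCLM.intervalIntegral_comp_comm hver
    simp only [Complex.reCLM_apply, Complex.imCLM_apply, Complex.smul_re, Complex.sub_re,
      Complex.sub_im, smul_eq_mul, ← mul_sub] at hre him
    rw [Complex.sub_re, Complex.I_mul_re, ← hre, ← him, ← green_im, neg_neg, sub_self,
      Complex.zero_re]
  · have him := Complex.imCLM.intervalIntegral_comp_comm hhor
    have hre := Complex.reCLM.intervalIntegral_comp_comm hver
    simp only [Complex.reCLM_apply, Complex.imCLM_apply, Complex.smul_im, Complex.sub_re,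
      Complex.sub_im, smul_eq_mul, ← mul_sub] at hre him
    rw [Complex.sub_im, Complex.I_mul_im, ← hre, ← him, ← green_re, sub_self, Complex.zero_im]

end Rectangle

theorem differentiableOn_of_cauchyRiemann (hα : 0 < α) {Ω : Set (ℝ × ℝ)} (hΩ : IsOpen Ω)
    {F : ℂ → ℂ} (hF : ContinuousOn F (meyerson α hα '' Ω))
    (h : ∀ ⦃a b c d : ℝ⦄, [[a, b]] ×ˢ [[c, d]] ⊆ Ω → ∃ ux uy vx vy : ℝ × ℝ → ℝ,
      HasACLGradient (fun p => (F (meyerson α hα p)).re) ux uy [[a, b]] [[c, d]] ∧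
      HasACLGradient (fun p => (F (meyerson α hα p)).im) vx vy [[a, b]] [[c, d]] ∧
      ∀ᵐ p ∂volume.restrict ([[a, b]] ×ˢ [[c, d]]),
        |p.1| ^ α * vy p = ux p ∧ |p.1| ^ α * uy p = -vx p) :
    DifferentiableOn ℂ F (meyerson α hα '' Ω) := by
  refine (Complex.isConservativeOn_and_continuousOn_iff_isDifferentiableOn
    ((meyerson α hα).isOpenMap _ hΩ)).1 ⟨fun z w hzw => ?_, hF⟩
  obtain ⟨⟨x₁, y₁⟩, rfl⟩ := (meyerson α hα).surjective z
  obtain ⟨⟨x₂, y₂⟩, rfl⟩ := (meyerson α hα).surjective w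
  have hR := (meyerson_image_rectangle_subset hα x₁ x₂ y₁ y₂).trans hzw
  obtain ⟨ux, uy, vx, vy, hu, hv, huv⟩ :=
    h ((image_subset_image_iff (meyerson α hα).injective).1 hR)
  exact eq_neg_of_add_eq_zero_left
    (wedgeIntegral_add_wedgeIntegral_eq_zero hα (hF.mono hR) hu hv huv)

end CauchyRiemann

/-! ### Holomorphy of the conjugate map -/

section Conjugate

variable {α : ℝ} {Ω Ω' : Set (ℝ × ℝ)}

theorem ext_apply (g : Ω ≃ₜ Ω') {p : ℝ × ℝ} (hp : p ∈ Ω) : ext g p = g ⟨p, hp⟩ :=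
  Subtype.val_injective.extend_apply _ _ (⟨p, hp⟩ : Ω)

theorem continuousOn_ext (g : Ω ≃ₜ Ω') : ContinuousOn (ext g) Ω := by
  have h : Ω.domRestrict (ext g) = fun p => (g p : ℝ × ℝ) := funext fun p => ext_apply g p.2
  rw [continuousOn_iff_continuous_domRestrict, h]
  fun_prop

theorem continuousOn_comp₁ (g : Ω ≃ₜ Ω') : ContinuousOn (comp₁ g) Ω :=
  continuous_fst.comp_continuousOn (continuousOn_ext g)

theorem continuousOn_comp₂ (g : Ω ≃ₜ Ω') : ContinuousOn (comp₂ g) Ω :=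
  continuous_snd.comp_continuousOn (continuousOn_ext g)

/-- The conjugate `φ_α ∘ g ∘ φ_α⁻¹` as a map of the complex plane, extended by zero outside
`φ_α(Ω)`. -/
noncomputable def conjugateExt (α : ℝ) (hα : 0 < α) (g : Ω ≃ₜ Ω') (z : ℂ) : ℂ :=
  meyerson α hα (ext g ((meyerson α hα).symm z))

theorem conjugateExt_meyerson (hα : 0 < α) (g : Ω ≃ₜ Ω') (p : ℝ × ℝ) :
    conjugateExt α hα g (meyerson α hα p) = ⟨stretch α (comp₁ g p), comp₂ g p⟩ := by
  rw [conjugateExt, Homeomorph.symm_apply_apply]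
  rfl

theorem conjugate_apply (hα : 0 < α) (g : Ω ≃ₜ Ω') (z : meyerson α hα '' Ω) :
    (conjugate α hα g z : ℂ) = conjugateExt α hα g z := by
  obtain ⟨_, p, hp, rfl⟩ := z
  have hsymm : ((meyerson α hα).image Ω).symm ⟨meyerson α hα p, mem_image_of_mem _ hp⟩ = ⟨p, hp⟩ :=
    (Homeomorph.symm_apply_eq _).2 rfl
  rw [conjugateExt, Homeomorph.symm_apply_apply, ext_apply g hp, conjugate,
    Homeomorph.trans_apply, Homeomorph.trans_apply, hsymm]
  rfl

theorem extend_conjugate (hα : 0 < α) (g : Ω ≃ₜ Ω') :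
    Function.extend Subtype.val (fun z => (conjugate α hα g z : ℂ)) 0 = conjugateExt α hα g := by
  funext z
  by_cases hz : z ∈ meyerson α hα '' Ω
  · exact (Subtype.val_injective.extend_apply _ _ (⟨z, hz⟩ : meyerson α hα '' Ω)).trans
      (conjugate_apply hα g ⟨z, hz⟩)
  · have hz' : ¬∃ p : Ω, (p : ℝ × ℝ) = (meyerson α hα).symm z := by
      rintro ⟨p, hp⟩
      exact hz ⟨p, p.2, (Homeomorph.eq_symm_apply _).1 hp⟩
    rw [Function.extend_apply' _ _ _ fun ⟨w, hw⟩ => hz (hw ▸ w.2), conjugateExt, ext,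
      Function.extend_apply' _ _ _ hz']
    simp [meyerson, stretch, Complex.ext_iff]

theorem continuousOn_conjugateExt (hα : 0 < α) (g : Ω ≃ₜ Ω') :
    ContinuousOn (conjugateExt α hα g) (meyerson α hα '' Ω) := by
  refine (meyerson α hα).continuous.comp_continuousOn ((continuousOn_ext g).comp
    (meyerson α hα).symm.continuous.continuousOn ?_)
  rintro _ ⟨p, hp, rfl⟩
  rwa [Homeomorph.symm_apply_apply]

/-- The pointwise part of the definition of a conformal map, without the Sobolev regularity. -/
structure IsPointwiseConformal (α : ℝ) (g : Ω ≃ₜ Ω') : Prop where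
  orthogonal : ∀ᵐ p : ℝ × ℝ, p ∈ regularSet g → p ∈ partialsSet g ∧
    ∃ c : ℝ, 0 < c ∧ ∃ O ∈ Matrix.orthogonalGroup (Fin 2) ℝ, grushinMatrix α g p = c • O
  limit : ∀ p₀ ∈ singularSet g, (𝓝[regularSet g ∩ partialsSet g] p₀).NeBot ∧
    ∃ L : Matrix (Fin 2) (Fin 2) ℝ, L ≠ 0 ∧
      Tendsto (grushinMatrix α g) (𝓝[regularSet g ∩ partialsSet g] p₀) (𝓝 L)

theorem smul_orthogonal_apply_of_det_pos {c : ℝ} {O : Matrix (Fin 2) (Fin 2) ℝ}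
    (hO : O ∈ Matrix.orthogonalGroup (Fin 2) ℝ) (hdet : 0 < (c • O).det) :
    (c • O) 0 0 = (c • O) 1 1 ∧ (c • O) 0 1 = -(c • O) 1 0 := by
  have hpos : 0 < O.det := by
    rw [Matrix.det_smul, Fintype.card_fin] at hdet
    exact pos_of_mul_pos_right hdet (sq_nonneg c)
  have hsq : O.det * O.det = 1 := by
    simpa only [Matrix.det_mul, Matrix.det_transpose, Matrix.det_one] using
      congrArg Matrix.det ((Matrix.mem_orthogonalGroup_iff (Fin 2) ℝ).1 hO)
  have hone : O.det = 1 := (mul_self_eq_one_iff.1 hsq).resolve_right (by linarith)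
  obtain ⟨hdiag, hanti, -⟩ := Matrix.mem_specialOrthogonalGroup_fin_two_iff.1
    (Matrix.mem_specialOrthogonalGroup_iff.2 ⟨hO, hone⟩)
  simp [hdiag, hanti]

theorem grushinMatrix_det (g : Ω ≃ₜ Ω') (p : ℝ × ℝ) :
    (grushinMatrix α g p).det = (horizontalMatrix α g p).det / |comp₁ g p| ^ α := by
  rw [grushinMatrix, horizontalMatrix, Matrix.det_fin_two_of, Matrix.det_fin_two_of]
  ring

theorem ae_fst_ne_zero : ∀ᵐ p : ℝ × ℝ, p.1 ≠ 0 :=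
  Measure.quasiMeasurePreserving_fst.ae (Measure.ae_ne volume 0)

theorem IsPointwiseConformal.ae_cauchyRiemann {g : Ω ≃ₜ Ω'} (hg : IsPointwiseConformal α g)
    (ho : IsOrientationPreserving α g) : ∀ᵐ p : ℝ × ℝ, p ∈ Ω → comp₁ g p ≠ 0 →
      Y α (comp₂ g) p = |comp₁ g p| ^ α * X (comp₁ g) p ∧
        |comp₁ g p| ^ α * Y α (comp₁ g) p = -X (comp₂ g) p := by
  filter_upwards [hg.orthogonal, ho.2, ae_fst_ne_zero] with p horth hor hp0 hp h0
  obtain ⟨-, c, -, O, hO, hM⟩ := horth ⟨hp, fun h => h.2.elim hp0 h0⟩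
  have hG : 0 < |comp₁ g p| ^ α := Real.rpow_pos_of_pos (abs_pos.2 h0) α
  have hdet : 0 < (c • O).det := by
    rw [← hM, grushinMatrix_det]
    exact div_pos (hor hp).2 hG
  obtain ⟨hdiag, hanti⟩ := smul_orthogonal_apply_of_det_pos hO hdet
  simp only [← hM, grushinMatrix, Matrix.of_apply, Matrix.cons_val', Matrix.cons_val_zero,
    Matrix.cons_val_one, Matrix.cons_val_fin_one] at hdiag hanti
  rw [hdiag, hanti]
  constructor <;> field_simp

/-- Where `g₁ = 0` the gradient of `g₁` vanishes almost everywhere, contradicting `J_g > 0`. -/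
theorem IsOrientationPreserving.ae_comp₁_ne_zero {g : Ω ≃ₜ Ω'} (ho : IsOrientationPreserving α g)
    {u v : ℝ × ℝ → ℝ} {a b c d : ℝ} (hR : [[a, b]] ×ˢ [[c, d]] ⊆ Ω)
    (h : HasACLGradient (comp₁ g) u v [[a, b]] [[c, d]]) :
    ∀ᵐ p ∂volume.restrict ([[a, b]] ×ˢ [[c, d]]), comp₁ g p ≠ 0 := by
  have hcont := (continuousOn_comp₁ g).mono hR
  filter_upwards [h.ae_partials_eq hcont, h.ae_eq_zero_of_eq_zero hcont,
    ae_restrict_of_ae ho.2, ae_restrict_mem (measurableSet_uIcc.prod measurableSet_uIcc)]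
    with p hpartial hzero hdet hp h0
  have hdet := (hdet (hR hp)).2
  rw [horizontalMatrix, Matrix.det_fin_two_of, Y, Y, hpartial.1, hpartial.2,
    (hzero h0).1, (hzero h0).2] at hdet
  simp only [mul_zero, zero_mul, sub_self, lt_self_iff_false] at hdet

theorem MemHWLoc.exists_hasACLGradient {r : ENNReal} {g : Ω ≃ₜ Ω'} (hg : MemHWLoc α r g)
    (hΩ : IsOpen Ω) {a b c d : ℝ} (hR : [[a, b]] ×ˢ [[c, d]] ⊆ Ω) :
    (∃ u v, HasACLGradient (comp₁ g) u v [[a, b]] [[c, d]]) ∧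
      ∃ u v, HasACLGradient (comp₂ g) u v [[a, b]] [[c, d]] := by
  obtain ⟨U, hU, hRU, hUΩ, hUc⟩ := exists_open_between_and_isCompact_closure
    (isCompact_uIcc.prod isCompact_uIcc) hΩ hR
  obtain ⟨h₁, h₂⟩ := hg U hU hUc hUΩ
  have hUΩ := subset_closure.trans hUΩ
  obtain ⟨u₁, v₁, h₁⟩ := h₁.exists_hasACLGradient hU ((continuousOn_comp₁ g).mono hUΩ)
  obtain ⟨u₂, v₂, h₂⟩ := h₂.exists_hasACLGradient hU ((continuousOn_comp₂ g).mono hUΩ)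
  exact ⟨⟨u₁, v₁, h₁ hRU⟩, u₂, v₂, h₂ hRU⟩

theorem IsPointwiseConformal.differentiableOn_conjugateExt (hα : 0 < α) (hΩ : IsOpen Ω)
    {g : Ω ≃ₜ Ω'} (hg : IsPointwiseConformal α g) (ho : IsOrientationPreserving α g) :
    DifferentiableOn ℂ (conjugateExt α hα g) (meyerson α hα '' Ω) := by
  refine differentiableOn_of_cauchyRiemann hα hΩ (continuousOn_conjugateExt hα g)
    fun a b c d hR => ?_
  obtain ⟨⟨u₁, v₁, h₁⟩, u₂, v₂, h₂⟩ := ho.1.exists_hasACLGradient hΩ hR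
  have hcont₁ := (continuousOn_comp₁ g).mono hR
  have h₁' := h₁.comp (contDiff_one_stretch hα) hcont₁
  simp only [conjugateExt_meyerson, deriv_stretch hα] at h₁' ⊢
  refine ⟨_, _, u₂, v₂, h₁', h₂, ?_⟩
  filter_upwards [h₁.ae_partials_eq hcont₁, h₂.ae_partials_eq ((continuousOn_comp₂ g).mono hR),
    ho.ae_comp₁_ne_zero hR h₁, ae_restrict_of_ae (hg.ae_cauchyRiemann ho),
    ae_restrict_mem (measurableSet_uIcc.prod measurableSet_uIcc)]
    with p hp₁ hp₂ h0 hCR hp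
  obtain ⟨hCR₁, hCR₂⟩ := hCR (hR hp) h0
  rw [Y, hp₁.1, hp₂.2] at hCR₁
  rw [Y, hp₁.2, hp₂.1] at hCR₂
  exact ⟨hCR₁, by rw [← hCR₂]; ring⟩

end Conjugate

/-! ### Derivatives of injective holomorphic functions -/

section Univalent

variable {U : Set ℂ} {F : ℂ → ℂ} {z : ℂ}

theorem not_eventually_eq_of_injOn (hU : IsOpen U) (hinj : InjOn F U) (hz : z ∈ U) :
    ¬∀ᶠ w in 𝓝 z, F w = F z := fun h => by
  have hsub : ∀ᶠ w in 𝓝 z, w = z :=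
    (h.and (hU.eventually_mem hz)).mono fun w hw => hinj hw.2 hz hw.1
  obtain ⟨w, hw, hne⟩ := ((hsub.filter_mono nhdsWithin_le_nhds).and self_mem_nhdsWithin).exists
    (f := 𝓝[≠] z)
  exact hne hw

theorem exists_openPartialHomeomorph_of_injOn (hU : IsOpen U) (hF : DifferentiableOn ℂ F U)
    (hinj : InjOn F U) : ∃ e : OpenPartialHomeomorph ℂ ℂ, ⇑e = F ∧ e.source = U := by
  have hopen : IsOpenMap (U.domRestrict F) := IsOpenMap.of_nhds_le fun z => by
    rw [domRestrict_eq, ← Filter.map_map, hU.isOpenEmbedding_subtypeVal.map_nhds_eq]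
    exact (hF.analyticAt (hU.mem_nhds z.2)).eventually_constant_or_nhds_le_map_nhds.resolve_left
      (not_eventually_eq_of_injOn hU hinj z.2)
  exact ⟨.ofContinuousOpenRestrict (hinj.toPartialEquiv F U) hF.continuousOn hopen hU, rfl, rfl⟩

theorem eventually_deriv_ne_zero_of_injOn (hU : IsOpen U) (hF : DifferentiableOn ℂ F U)
    (hinj : InjOn F U) (hz : z ∈ U) : ∀ᶠ w in 𝓝[≠] z, deriv F w ≠ 0 := by
  refine ((hF.deriv hU).analyticAt (hU.mem_nhds hz)).eventually_eq_zero_or_eventually_ne_zero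
    |>.resolve_left fun h => not_eventually_eq_of_injOn hU hinj hz ?_
  obtain ⟨ε, hε, hball⟩ := Metric.eventually_nhds_iff_ball.1 (h.and (hU.eventually_mem hz))
  filter_upwards [Metric.ball_mem_nhds z hε] with w hw
  exact Metric.isOpen_ball.is_const_of_deriv_eq_zero (convex_ball z ε).isPreconnected
    (hF.mono fun w hw => (hball w hw).2) (fun w hw => (hball w hw).1) hw
    (Metric.mem_ball_self hε)

/-- If `F'` vanished at `z`, then by Riemann's removable singularity theorem the inverse of `F`
would still be differentiable at `F z`, contradicting the chain rule. -/
theorem deriv_ne_zero_of_injOn (hU : IsOpen U) (hF : DifferentiableOn ℂ F U) (hinj : InjOn F U)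
    (hz : z ∈ U) : deriv F z ≠ 0 := by
  intro h0
  have hderiv := eventually_deriv_ne_zero_of_injOn hU hF hinj hz
  have hF' : ∀ w ∈ U, HasDerivAt F (deriv F w) w := fun w hw =>
    (hF.differentiableAt (hU.mem_nhds hw)).hasDerivAt
  obtain ⟨e, rfl, rfl⟩ := exists_openPartialHomeomorph_of_injOn hU hF hinj
  have hne := e.symm.eventually_ne_nhdsWithin (e.map_source hz)
  rw [e.left_inv hz] at hne
  have hsymm : DifferentiableAt ℂ e.symm (e z) := by
    refine (Complex.analyticAt_of_differentiable_on_punctured_nhds_of_continuousAt ?_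
      (e.continuousAt_symm (e.map_source hz))).differentiableAt
    have htendsto : Tendsto e.symm (𝓝[≠] (e z)) (𝓝[≠] z) :=
      tendsto_nhdsWithin_iff.2 ⟨(e.tendsto_symm hz).mono_left nhdsWithin_le_nhds, hne⟩
    filter_upwards [htendsto.eventually hderiv,
      nhdsWithin_le_nhds (e.open_target.mem_nhds (e.map_source hz))] with w hw hwt
    exact (e.hasDerivAt_symm hwt hw (hF' _ (e.map_target hwt))).differentiableAt
  have hid : HasDerivAt (e.symm ∘ e) 1 z :=
    (hasDerivAt_id z).congr_of_eventuallyEq (e.eventually_left_inverse hz)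
  have hchain := (hsymm.hasDerivAt.comp z (hF' z hz)).unique hid
  rw [h0, mul_zero] at hchain
  exact zero_ne_one hchain

end Univalent

/-! ### The derivatives of a map in terms of its conjugate -/

section Derivatives

variable {α : ℝ} {Ω Ω' : Set (ℝ × ℝ)} {g : Ω ≃ₜ Ω'}

theorem hasDerivAt_unstretch (hα : 0 < α) {x : ℝ} (hx : x ≠ 0) :
    HasDerivAt (unstretch α) (|x| ^ α)⁻¹ (stretch α x) := by
  refine HasDerivAt.of_local_left_inverse (continuous_unstretch hα).continuousAt ?_
    (Real.rpow_pos_of_pos (abs_pos.2 hx) α).ne' (Eventually.of_forall (stretch_unstretch hα))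
  rw [unstretch_stretch hα]
  exact hasDerivAt_stretch hα x

theorem hasDerivAt_meyerson_fst (hα : 0 < α) (p : ℝ × ℝ) :
    HasDerivAt (fun t => meyerson α hα (t, p.2)) ((|p.1| ^ α : ℝ) : ℂ) p.1 := by
  simp only [meyerson_eq hα]
  exact (hasDerivAt_stretch hα p.1).ofReal_comp.add_const _

theorem hasDerivAt_meyerson_snd (hα : 0 < α) (p : ℝ × ℝ) :
    HasDerivAt (fun t => meyerson α hα (p.1, t)) Complex.I p.2 := by
  simp only [meyerson_eq hα]
  simpa only [Complex.ofReal_one, one_mul, id] using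
    ((hasDerivAt_id p.2).ofReal_comp.mul_const Complex.I).const_add (stretch α p.1 : ℂ)

section Curve

variable {γ : ℝ → ℝ × ℝ} {t : ℝ} {w F' : ℂ}

theorem hasDerivAt_comp₁ (hα : 0 < α) (hγ : HasDerivAt (fun s => meyerson α hα (γ s)) w t)
    (hF : HasDerivAt (conjugateExt α hα g) F' (meyerson α hα (γ t)))
    (h0 : comp₁ g (γ t) ≠ 0) :
    HasDerivAt (fun s => comp₁ g (γ s)) ((|comp₁ g (γ t)| ^ α)⁻¹ * (F' * w).re) t := by
  have hcomp := HasDerivAt.comp (h₂ := conjugateExt α hα g) t hF hγ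
  have hre : HasDerivAt (fun s => (conjugateExt α hα g (meyerson α hα (γ s))).re) (F' * w).re t :=
    Complex.reCLM.hasFDerivAt.comp_hasDerivAt t hcomp
  simp only [conjugateExt_meyerson] at hre
  simpa only [Function.comp_def, unstretch_stretch hα] using
    (hasDerivAt_unstretch hα h0).comp t hre

theorem hasDerivAt_comp₂ (hα : 0 < α) (hγ : HasDerivAt (fun s => meyerson α hα (γ s)) w t)
    (hF : HasDerivAt (conjugateExt α hα g) F' (meyerson α hα (γ t))) :
    HasDerivAt (fun s => comp₂ g (γ s)) (F' * w).im t := by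
  have hcomp := HasDerivAt.comp (h₂ := conjugateExt α hα g) t hF hγ
  have him : HasDerivAt (fun s => (conjugateExt α hα g (meyerson α hα (γ s))).im) (F' * w).im t :=
    Complex.imCLM.hasFDerivAt.comp_hasDerivAt t hcomp
  simpa only [conjugateExt_meyerson] using him

end Curve

variable {p : ℝ × ℝ} {F' : ℂ}

theorem mem_partialsSet_of_hasDerivAt (hα : 0 < α) (hp : p ∈ Ω)
    (hF : HasDerivAt (conjugateExt α hα g) F' (meyerson α hα p)) (h0 : comp₁ g p ≠ 0) :
    p ∈ partialsSet g :=
  ⟨hp, ⟨(hasDerivAt_comp₁ hα (hasDerivAt_meyerson_fst hα p) hF h0).differentiableAt,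
    (hasDerivAt_comp₁ hα (hasDerivAt_meyerson_snd hα p) hF h0).differentiableAt⟩,
    (hasDerivAt_comp₂ hα (hasDerivAt_meyerson_fst hα p) hF).differentiableAt,
    (hasDerivAt_comp₂ hα (hasDerivAt_meyerson_snd hα p) hF).differentiableAt⟩

theorem grushinMatrix_eq_smul_leftMulMatrix (hα : 0 < α)
    (hF : HasDerivAt (conjugateExt α hα g) F' (meyerson α hα p)) (h0 : comp₁ g p ≠ 0) :
    grushinMatrix α g p =
      (|p.1| ^ α / |comp₁ g p| ^ α) • Algebra.leftMulMatrix Complex.basisOneI F' := by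
  rw [grushinMatrix, X, X, Y, Y,
    (hasDerivAt_comp₁ hα (hasDerivAt_meyerson_fst hα p) hF h0).deriv,
    (hasDerivAt_comp₁ hα (hasDerivAt_meyerson_snd hα p) hF h0).deriv,
    (hasDerivAt_comp₂ hα (hasDerivAt_meyerson_fst hα p) hF).deriv,
    (hasDerivAt_comp₂ hα (hasDerivAt_meyerson_snd hα p) hF).deriv, Algebra.leftMulMatrix_complex,
    Complex.re_mul_ofReal, Complex.im_mul_ofReal, Complex.mul_I_re, Complex.mul_I_im]
  ext i j
  fin_cases i <;> fin_cases j <;> simp <;> ring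

/-! ### Preservation of the axis -/

theorem continuous_leftMulMatrix : Continuous (Algebra.leftMulMatrix Complex.basisOneI) :=
  (Algebra.leftMulMatrix Complex.basisOneI).toLinearMap.continuous_of_finiteDimensional

theorem injOn_conjugateExt (hα : 0 < α) (g : Ω ≃ₜ Ω') :
    InjOn (conjugateExt α hα g) (meyerson α hα '' Ω) := fun z hz w hw h => by
  rw [← conjugate_apply hα g ⟨z, hz⟩, ← conjugate_apply hα g ⟨w, hw⟩] at h
  exact congrArg Subtype.val ((conjugate α hα g).injective (Subtype.ext h))

theorem hasDerivAt_conjugateExt (hα : 0 < α) (hΩ : IsOpen Ω)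
    (hF : DifferentiableOn ℂ (conjugateExt α hα g) (meyerson α hα '' Ω)) (hp : p ∈ Ω) :
    HasDerivAt (conjugateExt α hα g) (deriv (conjugateExt α hα g) (meyerson α hα p))
      (meyerson α hα p) :=
  (hF.differentiableAt (((meyerson α hα).isOpenMap _ hΩ).mem_nhds
    (mem_image_of_mem _ hp))).hasDerivAt

theorem deriv_conjugateExt_ne_zero (hα : 0 < α) (hΩ : IsOpen Ω)
    (hF : DifferentiableOn ℂ (conjugateExt α hα g) (meyerson α hα '' Ω)) (hp : p ∈ Ω) :
    deriv (conjugateExt α hα g) (meyerson α hα p) ≠ 0 :=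
  deriv_ne_zero_of_injOn ((meyerson α hα).isOpenMap _ hΩ) hF (injOn_conjugateExt hα g)
    (mem_image_of_mem _ hp)

theorem continuousAt_deriv_conjugateExt (hα : 0 < α) (hΩ : IsOpen Ω)
    (hF : DifferentiableOn ℂ (conjugateExt α hα g) (meyerson α hα '' Ω)) (hp : p ∈ Ω) :
    ContinuousAt (fun q => deriv (conjugateExt α hα g) (meyerson α hα q)) p := by
  have hopen := (meyerson α hα).isOpenMap _ hΩ
  have hderiv : ContinuousAt (deriv (conjugateExt α hα g)) (meyerson α hα p) :=
    (hF.deriv hopen).continuousOn.continuousAt (hopen.mem_nhds (mem_image_of_mem _ hp))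
  exact hderiv.comp (meyerson α hα).continuous.continuousAt

/-- Pass to the limit in `|g₁|^α D_α g = |x|^α F'`, where neither the limit of `D_α g` nor `F'`
vanishes. -/
theorem IsPointwiseConformal.comp₁_eq_zero_iff (hα : 0 < α) (hΩ : IsOpen Ω)
    (hg : IsPointwiseConformal α g)
    (hF : DifferentiableOn ℂ (conjugateExt α hα g) (meyerson α hα '' Ω)) (hp : p ∈ Ω) :
    comp₁ g p = 0 ↔ p.1 = 0 := by
  by_cases hS : p ∈ singularSet g
  swap
  · exact iff_of_false (fun h => hS ⟨hp, .inr h⟩) fun h => hS ⟨hp, .inl h⟩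
  obtain ⟨hbot, L, hL, hlim⟩ := hg.limit p hS
  have hcomp₁ : ContinuousAt (fun q => |comp₁ g q| ^ α) p :=
    (continuous_abs_rpow hα).continuousAt.comp
      ((continuousOn_comp₁ g).continuousAt (hΩ.mem_nhds hp))
  have hfst : ContinuousAt (fun q : ℝ × ℝ => |q.1| ^ α) p :=
    ((continuous_abs_rpow hα).comp continuous_fst).continuousAt
  have hright := (hfst.smul (continuous_leftMulMatrix.continuousAt.comp
    (continuousAt_deriv_conjugateExt hα hΩ hF hp))).tendsto.mono_left
      (nhdsWithin_le_nhds (s := regularSet g ∩ partialsSet g))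
  have hlimit : |comp₁ g p| ^ α • L = |p.1| ^ α • Algebra.leftMulMatrix Complex.basisOneI
      (deriv (conjugateExt α hα g) (meyerson α hα p)) := by
    refine tendsto_nhds_unique (((hcomp₁.tendsto.mono_left nhdsWithin_le_nhds).smul hlim).congr' ?_)
      hright
    filter_upwards [self_mem_nhdsWithin] with q hq
    have h0 : comp₁ g q ≠ 0 := fun h => hq.1.2 ⟨hq.1.1, .inr h⟩
    rw [grushinMatrix_eq_smul_leftMulMatrix hα (hasDerivAt_conjugateExt hα hΩ hF hq.1.1) h0,
      smul_smul, mul_div_cancel₀ _ (Real.rpow_pos_of_pos (abs_pos.2 h0) α).ne']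
    rfl
  have hM : Algebra.leftMulMatrix Complex.basisOneI
      (deriv (conjugateExt α hα g) (meyerson α hα p)) ≠ 0 :=
    (map_ne_zero_iff _ (Algebra.leftMulMatrix_injective _)).2
      (deriv_conjugateExt_ne_zero hα hΩ hF hp)
  have hzero := congrArg (· = 0) hlimit
  simpa only [smul_eq_zero, hL, hM, or_false, Real.rpow_eq_zero (abs_nonneg _) hα.ne',
    abs_eq_zero, eq_iff_iff] using hzero

end Derivatives

/-! ### Functions that are continuously differentiable off the axis -/

theorem integral_eq_zero_of_hasDerivAt_off_countable {E : Type*} [NormedAddCommGroup E]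
    [NormedSpace ℝ E] [CompleteSpace E] {h h' : ℝ → E} {s : Set ℝ} (hs : s.Countable)
    (hc : Continuous h) (hsupp : HasCompactSupport h) (hd : ∀ x ∉ s, HasDerivAt h (h' x) x)
    (hi : Integrable h') :
    ∫ x, h' x = 0 := by
  have hzero := hasCompactSupport_iff_eventuallyEq.1 hsupp
  rw [coclosedCompact_eq_cocompact, cocompact_eq_atBot_atTop, EventuallyEq, eventually_sup] at hzero
  refine tendsto_nhds_unique
    (intervalIntegral_tendsto_integral hi tendsto_neg_atTop_atBot tendsto_id)
    (tendsto_const_nhds.congr' ?_)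
  filter_upwards [tendsto_neg_atTop_atBot.eventually hzero.1, hzero.2, eventually_ge_atTop 0]
    with N hN hN' h0
  rw [id, integral_eq_of_hasDerivAt_off_countable_of_le h h' (by linarith) hs hc.continuousOn
    (fun x hx => hd x hx.2) hi.intervalIntegrable, hN, hN']
  exact (sub_self 0).symm

theorem IsTestFunction.integrable_mul {E : Type*} [NormedAddCommGroup E] [NormedSpace ℝ E]
    [MeasurableSpace E] [BorelSpace E] {μ : Measure E} {U : Set E} {f ψ : E → ℝ}
    (hψ : IsTestFunction U ψ) (hf : LocallyIntegrableOn f U μ) :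
    Integrable (fun x => f x * ψ x) μ := by
  have hK : IntegrableOn f (tsupport ψ) μ :=
    hf.integrableOn_compact_subset hψ.tsupport_subset hψ.hasCompactSupport
  refine (integrableOn_iff_integrable_of_support_subset ?_).1
    (hK.mul_continuousOn hψ.continuous.continuousOn hψ.hasCompactSupport)
  exact (Function.support_mul_subset_right _ _).trans (subset_tsupport ψ)

theorem IsTestFunction.continuous_mul {E : Type*} [NormedAddCommGroup E] [NormedSpace ℝ E]
    {U : Set E} {f ψ : E → ℝ} (hψ : IsTestFunction U ψ) (hU : IsOpen U) (hf : ContinuousOn f U) :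
    Continuous fun x => f x * ψ x :=
  (hf.mul hψ.continuous.continuousOn).continuous_of_tsupport_subset hU
    (tsupport_mul_subset_right.trans hψ.tsupport_subset)

theorem IsTestFunction.hasDerivAt_mul {E : Type*} [NormedAddCommGroup E] [NormedSpace ℝ E]
    {U : Set E} {f ψ : E → ℝ} (hψ : IsTestFunction U ψ) {γ : ℝ → E} {e : E} {t f' : ℝ}
    (hγ : HasDerivAt γ e t) (hf : γ t ∈ U → HasDerivAt (f ∘ γ) f' t) :
    HasDerivAt (fun s => f (γ s) * ψ (γ s)) (f' * ψ (γ t) + f (γ t) * fderiv ℝ ψ (γ t) e) t := by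
  by_cases hU : γ t ∈ tsupport ψ
  · exact (hf (hψ.tsupport_subset hU)).mul
      ((hψ.contDiff.differentiable (by simp) (γ t)).hasFDerivAt.comp_hasDerivAt t hγ)
  · have hzero := notMem_tsupport_iff_eventuallyEq.1 hU
    have hderiv : fderiv ℝ ψ (γ t) = 0 := by simp [hzero.fderiv_eq]
    rw [hderiv, hzero.eq_of_nhds]
    simp only [Pi.zero_apply, mul_zero, zero_apply, add_zero]
    refine (hasDerivAt_const t (0 : ℝ)).congr_of_eventuallyEq ?_
    filter_upwards [hγ.continuousAt.eventually hzero] with s hs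
    simp [hs]

theorem isWeakDeriv_fst_of_hasDerivAt {U S : Set (ℝ × ℝ)} (hU : IsOpen U)
    (hS : ∀ᵐ y, ((·, y) ⁻¹' S : Set ℝ).Countable) {f u : ℝ × ℝ → ℝ} (hf : ContinuousOn f U)
    (hd : ∀ p ∈ U \ S, HasDerivAt (fun t => f (t, p.2)) (u p) p.1)
    (hu : LocallyIntegrableOn u U) : IsWeakDeriv U (1, 0) f u := by
  have hfi : LocallyIntegrableOn f U := hf.locallyIntegrableOn hU.measurableSet
  refine isWeakDeriv_iff.2 ⟨hfi, hu, fun ψ hψ => ?_⟩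
  have huψ := hψ.integrable_mul hu
  have hfψ := (hψ.fderiv_apply (1, 0)).integrable_mul hfi
  have hsum : Integrable (fun p => u p * ψ p + f p * fderiv ℝ ψ p (1, 0))
    ((volume : Measure ℝ).prod volume) := huψ.add hfψ
  suffices H : ∫ p, (u p * ψ p + f p * fderiv ℝ ψ p (1, 0)) = 0 by
    rw [integral_add huψ hfψ] at H
    linarith
  rw [Measure.volume_eq_prod, integral_prod_symm _ hsum]
  refine integral_eq_zero_of_ae ?_
  filter_upwards [hsum.prod_left_ae, hS] with y hy hSy
  refine integral_eq_zero_of_hasDerivAt_off_countable (h := fun x => f (x, y) * ψ (x, y)) hSy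
    ((hψ.continuous_mul hU hf).comp (.prodMk_left y)) ?_ (fun x hx => ?_) hy
  · exact HasCompactSupport.of_support_subset_isCompact
      (hψ.hasCompactSupport.isCompact.image continuous_fst)
      fun x hx => ⟨(x, y), subset_tsupport _ (right_ne_zero_of_mul hx), rfl⟩
  · exact hψ.hasDerivAt_mul (γ := (·, y)) ((hasDerivAt_id x).prodMk (hasDerivAt_const x y))
      fun h => hd _ ⟨h, hx⟩

theorem isWeakDeriv_snd_of_hasDerivAt {U S : Set (ℝ × ℝ)} (hU : IsOpen U)
    (hS : ∀ᵐ x, ((x, ·) ⁻¹' S : Set ℝ).Countable) {f v : ℝ × ℝ → ℝ} (hf : ContinuousOn f U)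
    (hd : ∀ p ∈ U \ S, HasDerivAt (fun t => f (p.1, t)) (v p) p.2)
    (hv : LocallyIntegrableOn v U) : IsWeakDeriv U (0, 1) f v :=
  (isWeakDeriv_fst_of_hasDerivAt (S := Prod.swap ⁻¹' S) (hU.preimage continuous_swap) hS
    (hf.comp continuous_swap.continuousOn fun _ hp => hp) (fun p hp => hd p.swap hp)
    (locallyIntegrableOn_comp_swap hU hv)).comp_swap (hU.preimage continuous_swap)

theorem memLp_of_isBigO_one {E F : Type*} [TopologicalSpace E] [MeasurableSpace E]
    [NormedAddCommGroup F] {μ : Measure E} [IsFiniteMeasureOnCompacts μ] {K U : Set E} {u : E → F}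
    (hK : IsCompact K) (hUK : U ⊆ K) (hU : MeasurableSet U)
    (hu : AEStronglyMeasurable u (μ.restrict U)) (hb : ∀ x ∈ K, u =O[𝓝 x] fun _ => (1 : ℝ))
    (r : ENNReal) : MemLp u r (μ.restrict U) := by
  obtain ⟨C, hC⟩ : ∃ C, ∀ x ∈ K, ‖u x‖ ≤ C := by
    refine hK.induction_on (p := fun s => ∃ C, ∀ x ∈ s, ‖u x‖ ≤ C) ⟨0, by simp⟩
      (fun s t hst ⟨C, hC⟩ => ⟨C, fun x hx => hC x (hst hx)⟩) ?_ fun x hx => ?_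
    · rintro s t ⟨C, hC⟩ ⟨D, hD⟩
      exact ⟨max C D, fun x hx => hx.elim (fun h => (hC x h).trans (le_max_left _ _))
        fun h => (hD x h).trans (le_max_right _ _)⟩
    · obtain ⟨C, hC⟩ := (hb x hx).bound
      exact ⟨_, mem_nhdsWithin_of_mem_nhds hC, C, fun y hy => by simpa using hy⟩
  have : IsFiniteMeasure (μ.restrict K) := isFiniteMeasure_restrict.2 hK.measure_lt_top.ne
  have : IsFiniteMeasure (μ.restrict U) :=
    isFiniteMeasure_of_le _ (Measure.restrict_mono hUK le_rfl)
  exact MemLp.of_bound hu C (ae_restrict_of_forall_mem hU fun x hx => hC x (hUK hx))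

theorem aestronglyMeasurable_restrict_of_off_axis {Ω : Set (ℝ × ℝ)} (hΩ : IsOpen Ω)
    {k : ℝ × ℝ → ℝ} (hk : ContinuousOn k (Ω ∩ {p | p.1 ≠ 0})) :
    AEStronglyMeasurable k (volume.restrict Ω) := by
  have hae : (Ω ∩ {p : ℝ × ℝ | p.1 ≠ 0} : Set (ℝ × ℝ)) =ᵐ[volume] Ω :=
    inter_ae_eq_left_of_ae_eq_univ (eventuallyEq_univ.2 ae_fst_ne_zero)
  rw [← Measure.restrict_congr_set hae]
  exact hk.aestronglyMeasurable
    (hΩ.inter (isOpen_ne_fun continuous_fst continuous_const)).measurableSet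

theorem memHW_of_hasDerivAt {α : ℝ} (hα : 0 < α) {r : ENNReal} {Ω U : Set (ℝ × ℝ)}
    {f u v : ℝ × ℝ → ℝ} (hΩ : IsOpen Ω) (hf : ContinuousOn f Ω)
    (hfu : ∀ p ∈ Ω, p.1 ≠ 0 → HasDerivAt (fun t => f (t, p.2)) (u p) p.1)
    (hfv : ∀ p ∈ Ω, p.1 ≠ 0 → HasDerivAt (fun t => f (p.1, t)) (v p) p.2)
    (hu : ContinuousOn u (Ω ∩ {p | p.1 ≠ 0})) (hv : ContinuousOn v (Ω ∩ {p | p.1 ≠ 0}))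
    (hub : ∀ p ∈ Ω, u =O[𝓝 p] fun _ => (1 : ℝ)) (hvb : ∀ p ∈ Ω, v =O[𝓝 p] fun _ => (1 : ℝ))
    (hU : IsOpen U) (hUc : IsCompact (closure U)) (hUΩ : closure U ⊆ Ω) : MemHW α r U f := by
  have hUΩ' : U ⊆ Ω := subset_closure.trans hUΩ
  have hLp : ∀ {k : ℝ × ℝ → ℝ}, ContinuousOn k (Ω ∩ {p | p.1 ≠ 0}) →
      (∀ p ∈ Ω, k =O[𝓝 p] fun _ => (1 : ℝ)) → ∀ s, MemLp k s (volume.restrict U) :=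
    fun hk hkb => memLp_of_isBigO_one hUc subset_closure hU.measurableSet
      ((aestronglyMeasurable_restrict_of_off_axis hΩ hk).mono_set hUΩ') fun p hp => hkb p (hUΩ hp)
  have hfb : ∀ p ∈ Ω, f =O[𝓝 p] fun _ => (1 : ℝ) := fun p hp =>
    (hf.continuousAt (hΩ.mem_nhds hp)).tendsto.isBigO_one ℝ
  have hweight : Continuous fun p : ℝ × ℝ => |p.1| ^ α :=
    (continuous_abs_rpow hα).comp continuous_fst
  have hLoc : ∀ {k : ℝ × ℝ → ℝ}, MemLp k 1 (volume.restrict U) → LocallyIntegrableOn k U :=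
    fun hk => IntegrableOn.locallyIntegrableOn (memLp_one_iff_integrable.1 hk)
  refine ⟨hLp (hf.mono inter_subset_left) hfb r, u, v, ?_, ?_, hLp hu hub r,
    hLp (hweight.continuousOn.mul hv) (fun p hp => ?_) r⟩
  · refine isWeakDeriv_fst_of_hasDerivAt (S := {p | p.1 = 0}) hU ?_ (hf.mono hUΩ')
      (fun p hp => hfu p (hUΩ' hp.1) hp.2) (hLoc (hLp hu hub 1))
    exact Eventually.of_forall fun _ => countable_singleton 0
  · refine isWeakDeriv_snd_of_hasDerivAt (S := {p | p.1 = 0}) hU ?_ (hf.mono hUΩ')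
      (fun p hp => hfv p (hUΩ' hp.1) hp.2) (hLoc (hLp hv hvb 1))
    filter_upwards [Measure.ae_ne volume (0 : ℝ)] with x hx
    simp [hx]
  · simpa only [one_mul, Pi.mul_def] using
      (hweight.continuousAt.tendsto.isBigO_one ℝ).mul (hvb p hp)

/-! ### Holomorphic functions that preserve the imaginary axis -/

section ImaginaryAxis

open Asymptotics

variable {F : ℂ → ℂ} {F' z₀ : ℂ}

theorem tendsto_im_mul_I (h0 : z₀.re = 0) :
    Tendsto (fun z : ℂ => (z.im : ℂ) * Complex.I) (𝓝 z₀) (𝓝 z₀) :=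
  Continuous.tendsto' (by fun_prop) _ _ (by simp [Complex.ext_iff, h0])

theorem sub_im_mul_I (z : ℂ) : z - (z.im : ℂ) * Complex.I = z.re := by
  simp [Complex.ext_iff]

theorem im_eq_zero_of_hasDerivAt_of_re_eq_zero (hF : HasDerivAt F F' z₀) (h0 : z₀.re = 0)
    (hax : ∀ᶠ z in 𝓝 z₀, z.re = 0 → (F z).re = 0) : F'.im = 0 := by
  have hz₀ : z₀ = (z₀.im : ℂ) * Complex.I := by simp [Complex.ext_iff, h0]
  have hγ : HasDerivAt (fun t : ℝ => (t : ℂ) * Complex.I) Complex.I z₀.im := by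
    simpa only [Complex.ofReal_one, one_mul, id] using
      (hasDerivAt_id z₀.im).ofReal_comp.mul_const Complex.I
  have hre : HasDerivAt (fun t : ℝ => (F (t * Complex.I)).re) (F' * Complex.I).re z₀.im :=
    Complex.reCLM.hasFDerivAt.comp_hasDerivAt z₀.im
      (HasDerivAt.comp (h₂ := F) z₀.im (hz₀ ▸ hF) hγ)
  have hzero : (fun t : ℝ => (F (t * Complex.I)).re) =ᶠ[𝓝 z₀.im] fun _ => 0 := by
    filter_upwards [hγ.continuousAt.eventually (hz₀ ▸ hax)] with t ht using ht (by simp)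
  simpa using hre.unique ((hasDerivAt_const z₀.im (0 : ℝ)).congr_of_eventuallyEq hzero)

theorem isEquivalent_re (hF : HasStrictDerivAt F F' z₀) (hF' : F'.re ≠ 0) (h0 : z₀.re = 0)
    (hax : ∀ᶠ z in 𝓝 z₀, z.re = 0 → (F z).re = 0) :
    (fun z => (F z).re) ~[𝓝 z₀] fun z => F'.re * z.re := by
  have hdiff := hF.hasStrictFDerivAt.isLittleO.comp_tendsto
    (tendsto_id.prodMk_nhds (tendsto_im_mul_I h0))
  simp only [Function.comp_def, id, sub_im_mul_I] at hdiff
  have hre : (fun z => (F z).re - F'.re * z.re) =o[𝓝 z₀] Complex.re := by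
    refine IsBigO.trans_isLittleO (.of_bound' ?_)
      (hdiff.trans_isBigO (.of_bound' (Eventually.of_forall fun z => (Complex.norm_real _).le)))
    filter_upwards [(tendsto_im_mul_I h0).eventually hax] with z hz
    refine le_of_eq_of_le ?_ (Complex.abs_re_le_norm _)
    simp [hz, mul_comm F'.re]
  exact hre.const_mul_right hF'

theorem isBigO_im_re (hF : HasStrictDerivAt F F' z₀) (h0 : z₀.re = 0)
    (hax : ∀ᶠ z in 𝓝 z₀, z.re = 0 → (F z).im = 0) :
    (fun z => (F z).im) =O[𝓝 z₀] fun z => z.re := by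
  have hdiff := hF.hasStrictFDerivAt.isBigO_sub.comp_tendsto
    (tendsto_id.prodMk_nhds (tendsto_im_mul_I h0))
  simp only [Function.comp_def, id, sub_im_mul_I] at hdiff
  refine IsBigO.trans (.of_bound' ?_)
    (hdiff.trans (.of_bound' (Eventually.of_forall fun z => (Complex.norm_real _).le)))
  filter_upwards [(tendsto_im_mul_I h0).eventually hax] with z hz
  refine le_of_eq_of_le ?_ (Complex.abs_im_le_norm _)
  simp [hz]

theorem tendsto_re_div_re (hF : HasStrictDerivAt F F' z₀) (hF' : F'.re ≠ 0) (h0 : z₀.re = 0)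
    (hax : ∀ᶠ z in 𝓝 z₀, z.re = 0 → (F z).re = 0) :
    Tendsto (fun z => z.re / (F z).re) (𝓝[{z | z.re ≠ 0}] z₀) (𝓝 F'.re⁻¹) := by
  have hquot := ((IsEquivalent.refl (u := Complex.re)).div
    (isEquivalent_re hF hF' h0 hax)).mono (nhdsWithin_le_nhds (s := {z : ℂ | z.re ≠ 0}))
  refine hquot.symm.tendsto_nhds (tendsto_const_nhds.congr' ?_)
  filter_upwards [self_mem_nhdsWithin] with z (hz : z.re ≠ 0)
  rw [Pi.div_apply]
  field_simp

end ImaginaryAxis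

/-! ### Maps whose conjugate is holomorphic and preserves the axis -/

theorem stretch_eq_zero_iff {α : ℝ} (hα : 0 < α) {x : ℝ} : stretch α x = 0 ↔ x = 0 := by
  simp [stretch, hα.ne', (by linarith : α + 1 ≠ 0), Real.rpow_eq_zero]

theorem abs_rpow_div_abs_rpow {α : ℝ} (hα : 0 < α) (x y : ℝ) :
    |x| ^ α / |y| ^ α = |stretch α x / stretch α y| ^ (α / (α + 1)) := by
  have hα1 : 0 < α + 1 := by linarith
  have habs : ∀ t : ℝ, |stretch α t| = |t| ^ (α + 1) / (α + 1) := fun t => by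
    rw [stretch, abs_div, abs_mul, abs_of_pos hα1, Real.abs_rpow_of_nonneg (abs_nonneg t), abs_abs,
      add_comm α, Real.rpow_one_add' (abs_nonneg t) (by linarith)]
  rw [abs_div, habs, habs, div_div_div_cancel_right₀ hα1.ne', ← Real.div_rpow (by positivity)
    (by positivity), ← Real.div_rpow (by positivity) (by positivity), ← Real.rpow_mul
    (by positivity), mul_div_cancel₀ _ hα1.ne']

theorem exists_smul_orthogonal_eq_leftMulMatrix {w : ℂ} (hw : w ≠ 0) :
    ∃ O ∈ Matrix.orthogonalGroup (Fin 2) ℝ,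
      Algebra.leftMulMatrix Complex.basisOneI w = ‖w‖ • O := by
  have hn : ‖w‖ ≠ 0 := norm_ne_zero_iff.2 hw
  refine ⟨‖w‖⁻¹ • Algebra.leftMulMatrix Complex.basisOneI w, ?_, (smul_inv_smul₀ hn _).symm⟩
  have hsq : ‖w‖⁻¹ * w.re * (‖w‖⁻¹ * w.re) + ‖w‖⁻¹ * w.im * (‖w‖⁻¹ * w.im) = 1 := by
    have hnorm : w.re * w.re + w.im * w.im = ‖w‖ ^ 2 := by
      rw [← Complex.normSq_apply, Complex.normSq_eq_norm_sq]
    field_simp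
    linarith
  rw [Matrix.mem_orthogonalGroup_iff, Algebra.leftMulMatrix_complex]
  ext i j
  fin_cases i <;> fin_cases j <;> simp [Matrix.mul_apply, Fin.sum_univ_two] <;> linarith

section Converse

open Asymptotics

variable {α : ℝ} {Ω Ω' : Set (ℝ × ℝ)} {g : Ω ≃ₜ Ω'} {p : ℝ × ℝ}

/-- The conjugate `φ_α ∘ g ∘ φ_α⁻¹` is a biholomorphism that preserves the imaginary axis in both
directions, expressed through the components of `g` on the plane. -/
structure IsAxisBiholomorphic (hα : 0 < α) (g : Ω ≃ₜ Ω') : Prop where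
  differentiableOn : DifferentiableOn ℂ (conjugateExt α hα g) (meyerson α hα '' Ω)
  eq_zero_iff : ∀ p ∈ Ω, comp₁ g p = 0 ↔ p.1 = 0

namespace IsAxisBiholomorphic

variable {hα : 0 < α}

theorem comp₁_ne_zero (h : IsAxisBiholomorphic hα g) (hp : p ∈ Ω) (h0 : p.1 ≠ 0) :
    comp₁ g p ≠ 0 :=
  mt (h.eq_zero_iff p hp).1 h0

theorem eventually_re_eq_zero (h : IsAxisBiholomorphic hα g) (hΩ : IsOpen Ω) (hp : p ∈ Ω) :
    ∀ᶠ z in 𝓝 (meyerson α hα p), z.re = 0 → (conjugateExt α hα g z).re = 0 := by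
  filter_upwards [((meyerson α hα).isOpenMap _ hΩ).mem_nhds (mem_image_of_mem _ hp)]
  rintro _ ⟨q, hq, rfl⟩ (hre : stretch α q.1 = 0)
  rw [conjugateExt_meyerson]
  exact (stretch_eq_zero_iff hα).2 ((h.eq_zero_iff q hq).2 ((stretch_eq_zero_iff hα).1 hre))

theorem eventually_im_deriv_eq_zero (h : IsAxisBiholomorphic hα g) (hΩ : IsOpen Ω) (hp : p ∈ Ω) :
    ∀ᶠ z in 𝓝 (meyerson α hα p), z.re = 0 → (deriv (conjugateExt α hα g) z).im = 0 := by
  have hopen := (meyerson α hα).isOpenMap _ hΩ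
  filter_upwards [(h.eventually_re_eq_zero hΩ hp).eventually_nhds,
    hopen.mem_nhds (mem_image_of_mem _ hp)] with z hax hz hre
  exact im_eq_zero_of_hasDerivAt_of_re_eq_zero
    (h.differentiableOn.differentiableAt (hopen.mem_nhds hz)).hasDerivAt hre hax

theorem exists_tendsto_abs_rpow_div (h : IsAxisBiholomorphic hα g) (hΩ : IsOpen Ω) (hp : p ∈ Ω) :
    ∃ c > 0, Tendsto (fun q => |q.1| ^ α / |comp₁ g q| ^ α) (𝓝[{q | q.1 ≠ 0}] p) (𝓝 c) := by
  suffices H : ∃ c ≠ 0, Tendsto (fun q => stretch α q.1 / stretch α (comp₁ g q))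
      (𝓝[{q | q.1 ≠ 0}] p) (𝓝 c) by
    obtain ⟨c, hc, hlim⟩ := H
    refine ⟨|c| ^ (α / (α + 1)), Real.rpow_pos_of_pos (abs_pos.2 hc) _, ?_⟩
    simpa only [abs_rpow_div_abs_rpow hα] using hlim.abs.rpow_const (.inl (abs_ne_zero.2 hc))
  by_cases h0 : p.1 = 0
  · have hz₀ : (meyerson α hα p).re = 0 := (stretch_eq_zero_iff hα).2 h0
    have hF : HasStrictDerivAt (conjugateExt α hα g) _ (meyerson α hα p) :=
      (h.differentiableOn.analyticAt (((meyerson α hα).isOpenMap _ hΩ).mem_nhds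
        (mem_image_of_mem _ hp))).hasStrictDerivAt
    have hF' : (deriv (conjugateExt α hα g) (meyerson α hα p)).re ≠ 0 := fun hre =>
      deriv_conjugateExt_ne_zero hα hΩ h.differentiableOn hp
        (Complex.ext hre ((h.eventually_im_deriv_eq_zero hΩ hp).self_of_nhds hz₀))
    have hφ : Tendsto (meyerson α hα) (𝓝[{q | q.1 ≠ 0}] p)
        (𝓝[{z | z.re ≠ 0}] (meyerson α hα p)) :=
      (meyerson α hα).continuous.continuousWithinAt.tendsto_nhdsWithin
        fun q hq => (stretch_eq_zero_iff hα).not.2 hq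
    refine ⟨_, inv_ne_zero hF',
      ((tendsto_re_div_re hF hF' hz₀ (h.eventually_re_eq_zero hΩ hp)).comp hφ).congr fun q => ?_⟩
    rw [Function.comp_apply, conjugateExt_meyerson]
    rfl
  · have hc : stretch α (comp₁ g p) ≠ 0 := (stretch_eq_zero_iff hα).not.2 (h.comp₁_ne_zero hp h0)
    refine ⟨_, div_ne_zero ((stretch_eq_zero_iff hα).not.2 h0) hc, Tendsto.div ?_ ?_ hc⟩
    · exact ((continuous_stretch hα).comp continuous_fst).continuousWithinAt
    · exact ((continuous_stretch hα).continuousAt.comp ((continuousOn_comp₁ g).continuousAt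
        (hΩ.mem_nhds hp))).continuousWithinAt

theorem isBigO_abs_rpow_div (h : IsAxisBiholomorphic hα g) (hΩ : IsOpen Ω) (hp : p ∈ Ω) :
    (fun q => |q.1| ^ α / |comp₁ g q| ^ α) =O[𝓝 p] fun _ => (1 : ℝ) := by
  obtain ⟨c, -, hc⟩ := h.exists_tendsto_abs_rpow_div hΩ hp
  rw [← nhdsWithin_univ p, ← compl_union_self {q : ℝ × ℝ | q.1 ≠ 0}, nhdsWithin_union]
  refine IsBigO.sup (.of_bound' ?_) (hc.isBigO_one ℝ)
  filter_upwards [self_mem_nhdsWithin] with q hq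
  simp [not_not.1 hq, Real.zero_rpow hα.ne']

theorem isBigO_im_deriv (h : IsAxisBiholomorphic hα g) (hΩ : IsOpen Ω) (hp : p ∈ Ω) :
    (fun q => (deriv (conjugateExt α hα g) (meyerson α hα q)).im) =O[𝓝 p] fun q => |q.1| ^ α := by
  have hcont : Continuous fun q : ℝ × ℝ => |q.1| ^ α :=
    (continuous_abs_rpow hα).comp continuous_fst
  by_cases h0 : p.1 = 0
  · have hopen := (meyerson α hα).isOpenMap _ hΩ
    have hF' : HasStrictDerivAt (deriv (conjugateExt α hα g)) _ (meyerson α hα p) :=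
      ((h.differentiableOn.deriv hopen).analyticAt
        (hopen.mem_nhds (mem_image_of_mem _ hp))).hasStrictDerivAt
    have him := (isBigO_im_re hF' ((stretch_eq_zero_iff hα).2 h0)
      (h.eventually_im_deriv_eq_zero hΩ hp)).comp_tendsto (meyerson α hα).continuous.continuousAt
    have hstretch : (fun q : ℝ × ℝ => stretch α q.1) =O[𝓝 p] fun q => |q.1| ^ α := by
      have hfst : (fun q : ℝ × ℝ => q.1 / (α + 1)) =O[𝓝 p] fun _ => (1 : ℝ) :=
        (continuous_fst.div_const _).continuousAt.tendsto.isBigO_one ℝ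
      simpa only [stretch, mul_div_right_comm, one_mul] using
        hfst.mul (isBigO_refl (fun q : ℝ × ℝ => |q.1| ^ α) _)
    exact him.trans hstretch
  · have hne : |p.1| ^ α ≠ 0 := (Real.rpow_pos_of_pos (abs_pos.2 h0) α).ne'
    have hone : (fun _ => (1 : ℝ)) =O[𝓝 p] fun q : ℝ × ℝ => |q.1| ^ α :=
      (isBigO_const_const 1 hne _).trans
        ((isEquivalent_const_iff_tendsto hne).2 hcont.continuousAt).isBigO_symm
    exact ((Complex.continuous_im.continuousAt.comp (continuousAt_deriv_conjugateExt hα hΩ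
      h.differentiableOn hp)).tendsto.isBigO_one ℝ).trans hone

theorem memHW_comp₁ (h : IsAxisBiholomorphic hα g) (hΩ : IsOpen Ω) {U : Set (ℝ × ℝ)}
    (hU : IsOpen U) (hUc : IsCompact (closure U)) (hUΩ : closure U ⊆ Ω) (r : ENNReal) :
    MemHW α r U (comp₁ g) := by
  set D : ℝ × ℝ → ℂ := fun q => deriv (conjugateExt α hα g) (meyerson α hα q)
  have hF : ∀ p ∈ Ω, HasDerivAt (conjugateExt α hα g) (D p) (meyerson α hα p) := fun p hp =>
    hasDerivAt_conjugateExt hα hΩ h.differentiableOn hp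
  have hD : ∀ p ∈ Ω, ContinuousAt D p := fun p hp =>
    continuousAt_deriv_conjugateExt hα hΩ h.differentiableOn hp
  have hinv : ContinuousOn (fun p => (|comp₁ g p| ^ α)⁻¹) (Ω ∩ {p | p.1 ≠ 0}) :=
    ((continuous_abs_rpow hα).comp_continuousOn
      ((continuousOn_comp₁ g).mono inter_subset_left)).inv₀ fun p hp =>
        (Real.rpow_pos_of_pos (abs_pos.2 (h.comp₁_ne_zero hp.1 hp.2)) α).ne'
  have hcont : ∀ {w : ℝ × ℝ → ℂ}, Continuous w →
      ContinuousOn (fun p => (|comp₁ g p| ^ α)⁻¹ * (D p * w p).re) (Ω ∩ {p | p.1 ≠ 0}) :=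
    fun hw => hinv.mul (Complex.continuous_re.comp_continuousOn fun p hp =>
      ((hD p hp.1).mul hw.continuousAt).continuousWithinAt)
  have hbound : ∀ {w : ℝ × ℝ → ℂ}, (∀ p ∈ Ω, (fun q => (D q * w q).re) =O[𝓝 p] fun q => |q.1| ^ α) →
      ∀ p ∈ Ω, (fun q => (|comp₁ g q| ^ α)⁻¹ * (D q * w q).re) =O[𝓝 p] fun _ => (1 : ℝ) :=
    fun hw p hp => ((isBigO_refl _ _).mul (hw p hp)).trans
      (by simpa only [div_eq_inv_mul] using h.isBigO_abs_rpow_div hΩ hp)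
  refine memHW_of_hasDerivAt hα hΩ (continuousOn_comp₁ g)
    (fun p hp h0 => hasDerivAt_comp₁ hα (hasDerivAt_meyerson_fst hα p) (hF p hp)
      (h.comp₁_ne_zero hp h0))
    (fun p hp h0 => hasDerivAt_comp₁ hα (hasDerivAt_meyerson_snd hα p) (hF p hp)
      (h.comp₁_ne_zero hp h0))
    (hcont (w := fun p => ((|p.1| ^ α : ℝ) : ℂ))
      (Complex.continuous_ofReal.comp ((continuous_abs_rpow hα).comp continuous_fst)))
    (hcont (w := fun _ => Complex.I) continuous_const)
    (hbound (w := fun p => ((|p.1| ^ α : ℝ) : ℂ)) fun p hp => ?_)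
    (hbound (w := fun _ => Complex.I) fun p hp => ?_) hU hUc hUΩ
  · simpa only [Complex.re_mul_ofReal, one_mul, Function.comp_apply] using
      ((Complex.continuous_re.continuousAt.comp (hD p hp)).tendsto.isBigO_one ℝ).mul
        (isBigO_refl (fun q : ℝ × ℝ => |q.1| ^ α) _)
  · simpa only [Complex.mul_I_re] using (h.isBigO_im_deriv hΩ hp).neg_left

theorem memHW_comp₂ (h : IsAxisBiholomorphic hα g) (hΩ : IsOpen Ω) {U : Set (ℝ × ℝ)}
    (hU : IsOpen U) (hUc : IsCompact (closure U)) (hUΩ : closure U ⊆ Ω) (r : ENNReal) :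
    MemHW α r U (comp₂ g) := by
  set D : ℝ × ℝ → ℂ := fun q => deriv (conjugateExt α hα g) (meyerson α hα q)
  have hF : ∀ p ∈ Ω, HasDerivAt (conjugateExt α hα g) (D p) (meyerson α hα p) := fun p hp =>
    hasDerivAt_conjugateExt hα hΩ h.differentiableOn hp
  have hcont : ∀ {w : ℝ × ℝ → ℂ}, Continuous w →
      ∀ p ∈ Ω, ContinuousAt (fun q => (D q * w q).im) p := fun hw p hp =>
    Complex.continuous_im.continuousAt.comp
      ((continuousAt_deriv_conjugateExt hα hΩ h.differentiableOn hp).mul hw.continuousAt)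
  have hfst := hcont (w := fun p => ((|p.1| ^ α : ℝ) : ℂ))
    (Complex.continuous_ofReal.comp ((continuous_abs_rpow hα).comp continuous_fst))
  have hsnd := hcont (w := fun _ => Complex.I) continuous_const
  exact memHW_of_hasDerivAt hα hΩ (continuousOn_comp₂ g)
    (fun p hp _ => hasDerivAt_comp₂ hα (hasDerivAt_meyerson_fst hα p) (hF p hp))
    (fun p hp _ => hasDerivAt_comp₂ hα (hasDerivAt_meyerson_snd hα p) (hF p hp))
    (fun p hp => (hfst p hp.1).continuousWithinAt) (fun p hp => (hsnd p hp.1).continuousWithinAt)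
    (fun p hp => (hfst p hp).tendsto.isBigO_one ℝ) (fun p hp => (hsnd p hp).tendsto.isBigO_one ℝ)
    hU hUc hUΩ

theorem memHWLoc (h : IsAxisBiholomorphic hα g) (hΩ : IsOpen Ω) (r : ENNReal) : MemHWLoc α r g :=
  fun _ hU hUc hUΩ => ⟨h.memHW_comp₁ hΩ hU hUc hUΩ r, h.memHW_comp₂ hΩ hU hUc hUΩ r⟩

theorem mem_regularSet_inter_partialsSet (h : IsAxisBiholomorphic hα g) (hΩ : IsOpen Ω)
    (hp : p ∈ Ω) (h0 : p.1 ≠ 0) : p ∈ regularSet g ∩ partialsSet g :=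
  ⟨⟨hp, fun hS => hS.2.elim h0 (h.comp₁_ne_zero hp h0)⟩, mem_partialsSet_of_hasDerivAt hα hp
    (hasDerivAt_conjugateExt hα hΩ h.differentiableOn hp) (h.comp₁_ne_zero hp h0)⟩

theorem nhdsWithin_regularSet_inter_partialsSet (h : IsAxisBiholomorphic hα g) (hΩ : IsOpen Ω)
    (hp : p ∈ Ω) : 𝓝[regularSet g ∩ partialsSet g] p = 𝓝[{q | q.1 ≠ 0}] p := by
  refine le_antisymm (nhdsWithin_mono _ fun q hq h0 => hq.1.2 ⟨hq.1.1, .inl h0⟩)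
    (nhdsWithin_le_iff.2 ?_)
  filter_upwards [self_mem_nhdsWithin, mem_nhdsWithin_of_mem_nhds (hΩ.mem_nhds hp)]
    with q h0 hq using h.mem_regularSet_inter_partialsSet hΩ hq h0

theorem grushinMatrix_eq (h : IsAxisBiholomorphic hα g) (hΩ : IsOpen Ω) (hp : p ∈ Ω)
    (h0 : p.1 ≠ 0) :
    grushinMatrix α g p = (|p.1| ^ α / |comp₁ g p| ^ α) • Algebra.leftMulMatrix Complex.basisOneI
      (deriv (conjugateExt α hα g) (meyerson α hα p)) :=
  grushinMatrix_eq_smul_leftMulMatrix hα (hasDerivAt_conjugateExt hα hΩ h.differentiableOn hp)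
    (h.comp₁_ne_zero hp h0)

theorem exists_grushinMatrix_eq_smul_orthogonal (h : IsAxisBiholomorphic hα g) (hΩ : IsOpen Ω)
    (hp : p ∈ Ω) (h0 : p.1 ≠ 0) : ∃ c : ℝ, 0 < c ∧ ∃ O ∈ Matrix.orthogonalGroup (Fin 2) ℝ,
      grushinMatrix α g p = c • O := by
  have hF' := deriv_conjugateExt_ne_zero hα hΩ h.differentiableOn hp
  obtain ⟨O, hO, hmul⟩ := exists_smul_orthogonal_eq_leftMulMatrix hF'
  have hfst := Real.rpow_pos_of_pos (abs_pos.2 h0) α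
  have hcomp₁ := Real.rpow_pos_of_pos (abs_pos.2 (h.comp₁_ne_zero hp h0)) α
  exact ⟨_, mul_pos (div_pos hfst hcomp₁) (norm_pos_iff.2 hF'), O, hO,
    by rw [h.grushinMatrix_eq hΩ hp h0, hmul, smul_smul]⟩

theorem exists_tendsto_grushinMatrix (h : IsAxisBiholomorphic hα g) (hΩ : IsOpen Ω) (hp : p ∈ Ω) :
    ∃ L ≠ 0, Tendsto (grushinMatrix α g) (𝓝[{q | q.1 ≠ 0}] p) (𝓝 L) := by
  obtain ⟨c, hc, hlim⟩ := h.exists_tendsto_abs_rpow_div hΩ hp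
  have hmul := (continuous_leftMulMatrix.continuousAt.comp (continuousAt_deriv_conjugateExt hα hΩ
    h.differentiableOn hp)).tendsto.mono_left (nhdsWithin_le_nhds (s := {q | q.1 ≠ 0}))
  refine ⟨_, smul_ne_zero hc.ne' ((map_ne_zero_iff _ (Algebra.leftMulMatrix_injective _)).2
    (deriv_conjugateExt_ne_zero hα hΩ h.differentiableOn hp)), (hlim.smul hmul).congr' ?_⟩
  filter_upwards [self_mem_nhdsWithin, mem_nhdsWithin_of_mem_nhds (hΩ.mem_nhds hp)]
    with q h0 hq using (h.grushinMatrix_eq hΩ hq h0).symm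

theorem isPointwiseConformal (h : IsAxisBiholomorphic hα g) (hΩ : IsOpen Ω) :
    IsPointwiseConformal α g where
  orthogonal := by
    filter_upwards [ae_fst_ne_zero] with p h0 hp
    exact ⟨(h.mem_regularSet_inter_partialsSet hΩ hp.1 h0).2,
      h.exists_grushinMatrix_eq_smul_orthogonal hΩ hp.1 h0⟩
  limit p hp := by
    rw [h.nhdsWithin_regularSet_inter_partialsSet hΩ hp.1]
    have hdense : Dense {q : ℝ × ℝ | q.1 ≠ 0} :=
      (dense_compl_singleton (0 : ℝ)).preimage isOpenMap_fst
    exact ⟨mem_closure_iff_nhdsWithin_neBot.1 (hdense p), h.exists_tendsto_grushinMatrix hΩ hp.1⟩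

theorem det_horizontalMatrix_pos (h : IsAxisBiholomorphic hα g) (hΩ : IsOpen Ω) (hp : p ∈ Ω)
    (h0 : p.1 ≠ 0) : 0 < (horizontalMatrix α g p).det := by
  have hfst := Real.rpow_pos_of_pos (abs_pos.2 h0) α
  have hcomp₁ := Real.rpow_pos_of_pos (abs_pos.2 (h.comp₁_ne_zero hp h0)) α
  have hnorm := Complex.normSq_pos.2 (deriv_conjugateExt_ne_zero hα hΩ h.differentiableOn hp)
  rw [Complex.normSq_apply] at hnorm
  have hdet : 0 < (grushinMatrix α g p).det := by
    rw [h.grushinMatrix_eq hΩ hp h0, Matrix.det_smul, Algebra.leftMulMatrix_complex,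
      Matrix.det_fin_two_of, neg_mul, sub_neg_eq_add]
    exact mul_pos (pow_pos (div_pos hfst hcomp₁) _) hnorm
  rw [grushinMatrix_det] at hdet
  exact (div_pos_iff_of_pos_right hcomp₁).1 hdet

theorem isOrientationPreserving (h : IsAxisBiholomorphic hα g) (hΩ : IsOpen Ω) :
    IsOrientationPreserving α g := by
  refine ⟨h.memHWLoc hΩ 1, ?_⟩
  filter_upwards [ae_fst_ne_zero] with p h0 hp
  exact ⟨(h.mem_regularSet_inter_partialsSet hΩ hp h0).2, h.det_horizontalMatrix_pos hΩ hp h0⟩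

end IsAxisBiholomorphic

theorem isAxisBiholomorphic_iff (hα : 0 < α) (hΩ : IsOpen Ω) :
    IsAxisBiholomorphic hα g ↔ IsPointwiseConformal α g ∧ IsOrientationPreserving α g := by
  refine ⟨fun h => ⟨h.isPointwiseConformal hΩ, h.isOrientationPreserving hΩ⟩, fun ⟨hg, ho⟩ => ?_⟩
  have hF := hg.differentiableOn_conjugateExt hα hΩ ho
  exact ⟨hF, fun p hp => hg.comp₁_eq_zero_iff hα hΩ hF hp⟩

theorem conjugate_mem_axisBiholomorphisms_iff (hα : 0 < α) :
    conjugate α hα g ∈ axisBiholomorphisms (meyerson α hα '' Ω) (meyerson α hα '' Ω') ↔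
      IsAxisBiholomorphic hα g := by
  have haxis : (∀ z : meyerson α hα '' Ω, (conjugate α hα g z : ℂ).re = 0 ↔ (z : ℂ).re = 0) ↔
      ∀ p ∈ Ω, comp₁ g p = 0 ↔ p.1 = 0 := by
    simp only [conjugate_apply, Subtype.forall, forall_mem_image, conjugateExt_meyerson]
    exact forall₂_congr fun p _ => iff_congr (stretch_eq_zero_iff hα) (stretch_eq_zero_iff hα)
  rw [axisBiholomorphisms, mem_ofPred_eq, haxis, IsBiholomorphism, extend_conjugate]
  exact ⟨fun h => ⟨h.1, h.2⟩, fun h => ⟨h.1, h.2⟩⟩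

theorem grushinConformalMaps_eq (hα : 0 < α) (hΩ : IsOpen Ω) : grushinConformalMaps α Ω Ω' =
    {g | IsPointwiseConformal α g ∧ IsOrientationPreserving α g} := by
  ext g
  refine ⟨fun ⟨hg, ho, _⟩ => ⟨⟨hg.orthogonal, hg.limit⟩, ho⟩, fun ⟨hg, ho⟩ => ?_⟩
  have hr := ((isAxisBiholomorphic_iff hα hΩ).2 ⟨hg, ho⟩).memHWLoc hΩ
  exact ⟨⟨hr 2, hg.orthogonal, hg.limit⟩, ho, hr _⟩

end Converse

theorem bijective_conjugate {α : ℝ} (hα : 0 < α) (Ω Ω' : Set (ℝ × ℝ)) :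
    Function.Bijective (conjugate α hα : (Ω ≃ₜ Ω') → _) := by
  refine Function.bijective_iff_has_inverse.2 ⟨fun k =>
    (((meyerson α hα).image Ω).trans k).trans ((meyerson α hα).image Ω').symm, ?_, ?_⟩
  · intro g
    ext1 p
    simp [conjugate]
  · intro k
    ext1 z
    simp [conjugate]

end Grushin

open Grushin Set in
theorem theorem3_general (α : ℝ) (hα : 0 < α) (Ω Ω' : Set (ℝ × ℝ)) (hΩ : IsOpen Ω) :
    BijOn (conjugate α hα) {g | IsPointwiseConformal α g ∧ IsOrientationPreserving α g}
      (axisBiholomorphisms (meyerson α hα '' Ω) (meyerson α hα '' Ω')) ∧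
    ∀ g : Ω ≃ₜ Ω', IsPointwiseConformal α g → IsOrientationPreserving α g →
      (∀ r, MemHWLoc α r g) ∧ ∀ p : Ω, (g p : ℝ × ℝ).1 = 0 ↔ (p : ℝ × ℝ).1 = 0 := by
  have hmem : ∀ g : Ω ≃ₜ Ω', IsPointwiseConformal α g ∧ IsOrientationPreserving α g ↔
      conjugate α hα g ∈ axisBiholomorphisms (meyerson α hα '' Ω) (meyerson α hα '' Ω') :=
    fun g => (isAxisBiholomorphic_iff hα hΩ).symm.trans
      (conjugate_mem_axisBiholomorphisms_iff hα).symm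
  have hbij := bijective_conjugate hα Ω Ω'
  refine ⟨⟨fun g => (hmem g).1, hbij.1.injOn, fun k hk => ?_⟩, fun g hg ho => ?_⟩
  · obtain ⟨g, rfl⟩ := hbij.2 k
    exact mem_image_of_mem _ ((hmem g).2 hk)
  · have h := (isAxisBiholomorphic_iff hα hΩ).2 ⟨hg, ho⟩
    refine ⟨h.memHWLoc hΩ, fun p => ?_⟩
    simpa only [comp₁, ext_apply g p.2] using h.eq_zero_iff p p.2

theorem theorem3 (α : ℝ) (hα : 0 < α) (Ω Ω' : Set (ℝ × ℝ)) (hΩ : IsOpen Ω) (hΩ' : IsOpen Ω') :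
    Set.BijOn (Grushin.conjugate α hα)
      (Grushin.grushinConformalMaps α Ω Ω')
      (Grushin.axisBiholomorphisms (Grushin.meyerson α hα '' Ω) (Grushin.meyerson α hα '' Ω')) ∧
    ∀ g ∈ Grushin.grushinConformalMaps α Ω Ω', ∀ p : Ω,
      (g p : ℝ × ℝ).1 = 0 ↔ (p : ℝ × ℝ).1 = 0 := by
  have h := theorem3_general α hα Ω Ω' hΩ
  rw [Grushin.grushinConformalMaps_eq hα hΩ]
  exact ⟨h.1, fun g hg => (h.2 g hg.1 hg.2).2⟩
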